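/- Let $n\geq 1$, $d\geq 2$, let $A_1,\dots,A_n$ be qudits with computational basis $|0\rangle,\dots,|d-1\rangle$, and let $$|\psi\rangle_{A_1\cdots A_n}=\sqrt p\,\sum_{i=1}^{d-1}\bigl(a_{1i}|i0\cdots0\rangle+a_{2i}|0i0\cdots0\rangle+\cdots+a_{ni}|0\cdots0i\rangle\bigr)+\sqrt{1-p}\,|0\cdots0\rangle,$$ with $0\leq p\leq 1$, $a_{si}\in\mathbb C$ and $\sum_{s=1}^n\sum_{i=1}^{d-1}|a_{si}|^2=1$, be a superposition of a generalized $W$-class state and the vacuum (a GWV state). Let $P,P_0,\dots,P_{r-1}$ ($r\geq1$) be pairwise disjoint non-empty sets of the qudits $A_1,\dots,A_n$ (that is, a partition of some subset of the qudits), and for disjoint sets $X,Y$ of qudits let $\rho_{X|Y}$ (also written $\rho_{XY}$) be the reduced density matrix of $|\psi\rangle$ on $X\cup Y$, regarded as a bipartite state of $X$ and $Y$. For $\alpha>0$ the Rényi-$\alpha$ entanglement of a bipartite pure state $|\phi\rangle_{XY}$ is $E_\alpha(|\phi\rangle)=S_\alpha(\operatorname{tr}_Y|\phi\rangle\langle\phi|)$,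 where $S_\alpha(\sigma)=\frac1{1-\alpha}\log_2\operatorname{tr}\sigma^\alpha$ for $\alpha\neq1$ and $S_1(\sigma)=-\operatorname{tr}\sigma\log_2\sigma$; for a mixed state, $E_\alpha(\rho_{X|Y})$ is the minimum of $\sum_i p_iE_\alpha(|\phi_i\rangle)$ over all pure state decompositions $\rho_{X|Y}=\sum_i p_i|\phi_i\rangle\langle\phi_i|$. Let $\alpha\geq\frac{\sqrt7-1}{2}$, $\beta\geq2$ and $0<k\leq1$, and suppose that $k\,E_\alpha^2(\rho_{PP_j})\geq E_\alpha^2(\rho_{PP_{j+1}})$ for $j=0,1,\dots,r-2$. Then $$E_\alpha^\beta(\rho_{P|P_0\cdots P_{r-1}})\;\geq\;\sum_{j=0}^{r-1}\mathcal K_\beta^{\,\omega_H(j)}\,E_\alpha^\beta(\rho_{PP_j}),\qquad \mathcal K_\beta=\frac{(1+k)^{\beta/2}-1}{k^{\beta/2}},$$ where $\omega_H(j)$ is the number of ones in the binary expansion of $j$. -/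

import Mathlib

namespace GWV

/-! ### Bipartite systems: Rényi entropy and Rényi entanglement -/

section Bipartite

variable {a b : Type*} [Fintype a] [Fintype b]

/-- The reduced density matrix `ρ_A = tr_B |φ⟩⟨φ|` of a pure bipartite state `φ`. -/
noncomputable def reducedLeft {a b : Type*} [Fintype b] (φ : a × b → ℂ) : Matrix a a ℂ :=
  fun i i' => ∑ j, φ (i, j) * star (φ (i', j))

theorem reducedLeft_isHermitian {a b : Type*} [Fintype b] (φ : a × b → ℂ) : (reducedLeft φ).IsHermitian := by
  ext i i'
  simp [reducedLeft, Matrix.conjTranspose_apply, mul_comm]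

/-- The Rényi-`α` entropy `S_α(ρ) = (1 - α)⁻¹ log₂ tr ρ^α`, where `tr ρ^α` is the sum of the
`α`-th powers of the eigenvalues of `ρ`; for `α = 1` it is its limit, the von Neumann entropy
`- tr ρ log₂ ρ`. -/
noncomputable def renyiEntropy [DecidableEq a] (α : ℝ) (ρ : Matrix a a ℂ)
    (hρ : ρ.IsHermitian) : ℝ :=
  if α = 1 then -∑ i, hρ.eigenvalues i * Real.logb 2 (hρ.eigenvalues i)
  else 1 / (1 - α) * Real.logb 2 (∑ i, hρ.eigenvalues i ^ α)

/-- The Rényi-`α` entanglement `S_α(ρ_A)` of a pure bipartite state. -/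
noncomputable def pureRenyiEntanglement [DecidableEq a] (α : ℝ) (φ : a × b → ℂ) : ℝ :=
  renyiEntropy α (reducedLeft φ) (reducedLeft_isHermitian φ)

/-- `{q_k, |φ_k⟩}` is a pure state decomposition of the density matrix `ρ`:
`ρ = ∑_k q_k |φ_k⟩⟨φ_k|` with probabilities `q_k` and unit vectors `φ_k`. -/
def IsPureDecomposition (ρ : Matrix (a × b) (a × b) ℂ) {m : ℕ} (q : Fin m → ℝ)
    (φ : Fin m → a × b → ℂ) : Prop :=
  (∀ k, 0 ≤ q k) ∧ ∑ k, q k = 1 ∧ (∀ k, ∑ x, ‖φ k x‖ ^ 2 = 1) ∧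
    ρ = ∑ k, (q k : ℂ) • Matrix.vecMulVec (φ k) (star (φ k))

/-- The Rényi-`α` entanglement of a mixed bipartite state: the least average pure state
entanglement over all pure state decompositions. -/
noncomputable def renyiEntanglement [DecidableEq a] (α : ℝ)
    (ρ : Matrix (a × b) (a × b) ℂ) : ℝ :=
  sInf {x : ℝ | ∃ (m : ℕ) (q : Fin m → ℝ) (φ : Fin m → a × b → ℂ),
    IsPureDecomposition ρ q φ ∧ x = ∑ k, q k * pureRenyiEntanglement α (φ k)}

end Bipartite

/-! ### Systems of `n` qudits

A vector of the system is a function on the computational basis `Fin n → Fin d`. -/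

section Multipartite

variable {n d : ℕ}

/-- The basis label of the whole system with values `s` on the qudits in `S` and `e` on
the others. -/
def extend (S : Finset (Fin n)) (s : S → Fin d) (e : {i // i ∉ S} → Fin d) : Fin n → Fin d :=
  fun i => if h : i ∈ S then s ⟨i, h⟩ else e ⟨i, h⟩

/-- The reduced density matrix `ρ_S` of the pure state `ψ` on the qudits in `S`: the partial
trace of `|ψ⟩⟨ψ|` over all other qudits. -/
noncomputable def reducedDensity (ψ : (Fin n → Fin d) → ℂ) (S : Finset (Fin n)) :
    Matrix (S → Fin d) (S → Fin d) ℂ :=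
  fun s s' => ∑ e : {i // i ∉ S} → Fin d,
    Matrix.vecMulVec ψ (star ψ) (extend S s e) (extend S s' e)

/-- For disjoint `X` and `Y`, the identification of a pair of basis labels of `X` and of `Y`
with a basis label of `X ∪ Y`. -/
def glue (X Y : Finset (Fin n)) (u : (X → Fin d) × (Y → Fin d)) :
    (X ∪ Y : Finset (Fin n)) → Fin d :=
  fun i => if h : i.1 ∈ X then u.1 ⟨i.1, h⟩
    else u.2 ⟨i.1, (Finset.mem_union.1 i.2).resolve_left h⟩

/-- The reduced density matrix `ρ_{X ∪ Y}`, viewed as a bipartite state `ρ_{X|Y}`. -/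
noncomputable def bipartiteDensity (ψ : (Fin n → Fin d) → ℂ) (X Y : Finset (Fin n)) :
    Matrix ((X → Fin d) × (Y → Fin d)) ((X → Fin d) × (Y → Fin d)) ℂ :=
  (reducedDensity ψ (X ∪ Y)).submatrix (glue X Y) (glue X Y)

/-- The Rényi-`α` entanglement `E_α(ρ_{X|Y})` of the reduced state of `ψ` on `X ∪ Y` with
respect to the cut between `X` and `Y`. -/
noncomputable def cutEntanglement (α : ℝ) (ψ : (Fin n → Fin d) → ℂ) (X Y : Finset (Fin n)) : ℝ :=
  renyiEntanglement α (bipartiteDensity ψ X Y)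

/-- The computational basis vector `|x⟩`. -/
noncomputable def ket (x : Fin n → Fin d) : (Fin n → Fin d) → ℂ :=
  Pi.single x 1

/-- The generalized `W`-class vector `∑_s ∑_{i = 1}^{d-1} a_{si} |0 ⋯ 0 i 0 ⋯ 0⟩`, with the
`i` at the `s`-th place. -/
noncomputable def wVector [NeZero d] (a : Fin n → Fin d → ℂ) : (Fin n → Fin d) → ℂ :=
  ∑ s, ∑ i ∈ Finset.univ.erase 0, a s i • ket (Function.update (fun _ => 0) s i)

/-- `ψ` is a superposition `√p |W⟩ + √(1-p) |0⋯0⟩` of a (normalized) generalized `W`-class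
state and the vacuum. -/
def IsGWV [NeZero d] (ψ : (Fin n → Fin d) → ℂ) : Prop :=
  ∃ (p : ℝ) (a : Fin n → Fin d → ℂ), 0 ≤ p ∧ p ≤ 1 ∧
    ∑ s, ∑ i ∈ Finset.univ.erase 0, ‖a s i‖ ^ 2 = 1 ∧
    ψ = (Real.sqrt p : ℂ) • wVector a + (Real.sqrt (1 - p) : ℂ) • ket (fun _ => 0)

end Multipartite

/-- The Hamming weight of the vector of binary digits of `j`. -/
def hammingWeight (j : ℕ) : ℕ := (Nat.digits 2 j).count 1

end GWV

open Set
namespace GWV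

/-! A GWV state only involves basis labels with at most one excited qudit. On `X ∪ Y` an excited
environment leaves the vacuum, so ρ_{X|Y} = |x⟩⟨x| + c|0⟩⟨0|, where `x` lives on the row and the
column through the vacuum label (a "cross"). In any pure state decomposition, every member of
positive weight is a multiple of `x` off the vacuum (`exists_coeff_of_sum_eq`). It therefore has
Schmidt rank at most two, and its entanglement is f(C), where f is `renyiOfConcurrence` and C its
concurrence; the mean of C is the same for all decompositions, namely 2√(w(X)w(Y)) with w the total
`siteWeight`.

Since f is convex for α ≥ (√7 - 1)/2 (`convexOn_renyiOfConcurrence`), Jensen bounds the average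
entanglement below by f of the mean, and two states of equal concurrence attain the bound
(`renyiEntanglement_of_cross`, `cutEntanglement_eq`). The squared concurrence 4w(P)w(Y) is additive
over disjoint `Y`; with f(0) = 0 and convexity this makes E_α² superadditive
(`sum_sq_renyiOfConcurrence_le`). What remains is a real inequality with exponent β/2 ≥ 1, proved by
pairing neighbours repeatedly (`sum_hammingWeight_rpow_le`).

Convexity of f is checked in the parameter C = 1/cosh t, where the sign of the second derivative
becomes that of a combination of hyperbolic sines whose Taylor coefficients all have one sign. -/

/-! ### An inequality between hyperbolic sines -/

/-- Tangent lines at y = 1, multiplied by 3. The even and odd combinations feed each other in the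
recurrence, so the two bounds are proved together. -/
theorem tangent_bounds_two_add_pow {y : ℝ} (hy : 1 ≤ y) (j : ℕ) :
    3 * (3 ^ j + 1) + j * (3 ^ j - 3) * (y - 1) ≤ 3 * ((2 + y) ^ j + (2 - y) ^ j) ∧
      3 * (3 ^ j - 1) + j * (3 ^ j + 3) * (y - 1) ≤ 3 * ((2 + y) ^ j - (2 - y) ^ j) := by
  induction j with
  | zero => norm_num
  | succ j ih =>
    obtain ⟨h1, h2⟩ := ih
    -- For j = 0 the factor 3 ^ j - 3 is negative, and the general step needs it nonnegative.
    rcases Nat.eq_zero_or_pos j with rfl | hj0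
    · refine ⟨?_, ?_⟩ <;> norm_num
      linarith
    have h7 : (3 : ℝ) ≤ 3 ^ j := le_self_pow₀ (by norm_num) hj0.ne'
    have hy' : 0 ≤ y - 1 := by linarith
    have e1 : (2 + y) ^ (j + 1) + (2 - y) ^ (j + 1) =
        2 * ((2 + y) ^ j + (2 - y) ^ j) + y * ((2 + y) ^ j - (2 - y) ^ j) := by ring
    have e2 : (2 + y) ^ (j + 1) - (2 - y) ^ (j + 1) =
        2 * ((2 + y) ^ j - (2 - y) ^ j) + y * ((2 + y) ^ j + (2 - y) ^ j) := by ring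
    rw [e1, e2]
    generalize (2 + y) ^ j + (2 - y) ^ j = U at *
    generalize (2 + y) ^ j - (2 - y) ^ j = V at *
    have h4 := mul_le_mul_of_nonneg_left h1 (by linarith : 0 ≤ y)
    have h5 := mul_le_mul_of_nonneg_left h2 (by linarith : 0 ≤ y)
    have h6 : 0 ≤ j * (3 ^ j + 3) * (y - 1) * (y - 1) := by positivity
    have h8 : 0 ≤ j * (3 ^ j - 3) * (y - 1) * (y - 1) := by
      have : (0 : ℝ) ≤ 3 ^ j - 3 := by linarith
      positivity
    push_cast
    rw [pow_succ]
    constructor <;> nlinarith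

/-- With J = 2i + 1 ≥ 3 and T = 3^J, the tangent bound and Bernoulli's inequality for y^J leave (y -
1)((J/3 - 1)T + 3J - 1) ≥ 0. -/
theorem sinh_coeff_nonneg {y : ℝ} (hy : 1 ≤ y) (i : ℕ) :
    y + 4 + y * 3 ^ (2 * i + 1) ≤
      (y + 2) ^ (2 * i + 1) + (2 - y) ^ (2 * i + 1) + 4 * y ^ (2 * i + 1) := by
  rcases Nat.eq_zero_or_pos i with rfl | hi
  · simp; linarith
  have h := (tangent_bounds_two_add_pow hy (2 * i + 1)).1
  have hb : 1 + ((2 * i + 1 : ℕ) : ℝ) * (y - 1) ≤ y ^ (2 * i + 1) := by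
    have := one_add_mul_le_pow (a := y - 1) (by linarith) (2 * i + 1)
    simpa using this
  have hj : (3 : ℝ) ≤ ((2 * i + 1 : ℕ) : ℝ) := by
    norm_cast; omega
  have h3 : (0 : ℝ) < 3 ^ (2 * i + 1) := by positivity
  rw [add_comm y 2]
  generalize ((2 * i + 1 : ℕ) : ℝ) = J at *
  generalize (3 : ℝ) ^ (2 * i + 1) = T at *
  have h5 : 0 ≤ ((J - 3) * T) * (y - 1) :=
    mul_nonneg (mul_nonneg (by linarith) h3.le) (by linarith)
  have h6 : 0 ≤ J * (y - 1) := mul_nonneg (by linarith) (by linarith)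
  nlinarith

theorem sinh_coeff_nonpos {y : ℝ} (hy : 3 / 5 ≤ y) (hy1 : y ≤ 1) (hq : 0 ≤ y ^ 2 + 4 * y - 3)
    (i : ℕ) :
    (y + 2) ^ (2 * i + 1) + (2 - y) ^ (2 * i + 1) + 4 * y ^ (2 * i + 1) ≤
      y + 4 + y * 3 ^ (2 * i + 1) := by
  -- The linear coefficient vanishes; the cubic one is 4(y - 1)(y² + 4y - 3), whose root y = √7 - 2
  -- is the threshold on α.
  rcases i with _ | _ | i
  · simp; linarith
  · norm_num
    nlinarith [mul_nonneg (by linarith : 0 ≤ 1 - y) hq]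
  set j := 2 * (i + 1 + 1) + 1 with hj
  have hconv : ConvexOn ℝ (Icc (3 / 5 : ℝ) 1)
      (fun x : ℝ => (x + 2) ^ j + (2 - x) ^ j + 4 * x ^ j + (-(x * (1 + 3 ^ j)) - 4)) := by
    have hp := convexOn_pow (𝕜 := ℝ) j
    have c1 : ConvexOn ℝ (Icc (3 / 5 : ℝ) 1) (fun x : ℝ => (x + 2) ^ j) := by
      refine ⟨convex_Icc _ _, fun a ha b hb s t hs ht hst => ?_⟩
      have := hp.2 (x := a + 2) (mem_Ici.2 (by linarith [ha.1]))
        (y := b + 2) (mem_Ici.2 (by linarith [hb.1])) hs ht hst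
      simp only [smul_eq_mul] at this ⊢
      rwa [show s * (a + 2) + t * (b + 2) = s * a + t * b + 2 by linear_combination 2 * hst]
        at this
    have c2 : ConvexOn ℝ (Icc (3 / 5 : ℝ) 1) (fun x : ℝ => (2 - x) ^ j) := by
      refine ⟨convex_Icc _ _, fun a ha b hb s t hs ht hst => ?_⟩
      have := hp.2 (x := 2 - a) (mem_Ici.2 (by linarith [ha.2]))
        (y := 2 - b) (mem_Ici.2 (by linarith [hb.2])) hs ht hst
      simp only [smul_eq_mul] at this ⊢
      rwa [show s * (2 - a) + t * (2 - b) = 2 - (s * a + t * b) by linear_combination 2 * hst]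
        at this
    have c3 : ConvexOn ℝ (Icc (3 / 5 : ℝ) 1) (fun x : ℝ => 4 * x ^ j) :=
      (hp.subset (fun x hx => mem_Ici.2 (by linarith [hx.1])) (convex_Icc _ _)).smul
        (by norm_num : (0 : ℝ) ≤ 4)
    have c4 : ConvexOn ℝ (Icc (3 / 5 : ℝ) 1) (fun x : ℝ => -(x * (1 + 3 ^ j)) - 4) := by
      refine ⟨convex_Icc _ _, fun a _ b _ s t _ _ hst => le_of_eq ?_⟩
      simp only [smul_eq_mul]
      linear_combination 4 * hst
    exact ((c1.add c2).add c3).add c4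
  -- By convexity only the endpoints matter: the value at 1 is 0, and at 3/5 the negative term wins
  -- because (13/15)^5 + (7/15)^5 < 3/5.
  have hmax := hconv.le_max_of_mem_Icc (left_mem_Icc.2 (by norm_num))
    (right_mem_Icc.2 (by norm_num)) (z := y) ⟨hy, hy1⟩
  have h5 : 5 ≤ j := by omega
  have k1 : ((13 : ℝ) / 15) ^ j ≤ (13 / 15) ^ 5 :=
    pow_le_pow_of_le_one (by norm_num) (by norm_num) h5
  have k2 : ((7 : ℝ) / 15) ^ j ≤ (7 / 15) ^ 5 :=
    pow_le_pow_of_le_one (by norm_num) (by norm_num) h5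
  have k3 : ((3 : ℝ) / 5) ^ j ≤ (3 / 5) ^ 5 :=
    pow_le_pow_of_le_one (by norm_num) (by norm_num) h5
  have e1 : ((3 : ℝ) / 5 + 2) ^ j = (13 / 15) ^ j * 3 ^ j := by rw [← mul_pow]; norm_num
  have e2 : (2 - (3 : ℝ) / 5) ^ j = (7 / 15) ^ j * 3 ^ j := by rw [← mul_pow]; norm_num
  have h3 : (0 : ℝ) < 3 ^ j := by positivity
  have hle : max (((3 : ℝ) / 5 + 2) ^ j + (2 - 3 / 5) ^ j + 4 * (3 / 5) ^ j +
        (-(3 / 5 * (1 + 3 ^ j)) - 4))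
      (((1 : ℝ) + 2) ^ j + (2 - 1) ^ j + 4 * 1 ^ j + (-(1 * (1 + 3 ^ j)) - 4)) ≤ 0 := by
    refine max_le ?_ (le_of_eq ?_)
    · rw [e1, e2]
      have m1 := mul_le_mul_of_nonneg_right k1 h3.le
      have m2 := mul_le_mul_of_nonneg_right k2 h3.le
      linarith
    · norm_num; ring
  linarith [hmax.trans hle]

theorem hasSum_sinh_combination (y t : ℝ) :
    HasSum (fun i : ℕ => ((y + 2) ^ (2 * i + 1) + (2 - y) ^ (2 * i + 1) + 4 * y ^ (2 * i + 1) -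
        (y + 4 + y * 3 ^ (2 * i + 1))) * (t ^ (2 * i + 1) / (2 * i + 1).factorial))
      (Real.sinh ((y + 2) * t) + Real.sinh ((2 - y) * t) + 4 * Real.sinh (y * t) -
        ((y + 4) * Real.sinh t + y * Real.sinh (3 * t))) := by
  have h := (((Real.hasSum_sinh ((y + 2) * t)).add (Real.hasSum_sinh ((2 - y) * t))).add
    ((Real.hasSum_sinh (y * t)).mul_left 4)).sub
    (((Real.hasSum_sinh t).mul_left (y + 4)).add ((Real.hasSum_sinh (3 * t)).mul_left y))
  have e (i : ℕ) : ((y + 2) * t) ^ (2 * i + 1) / (2 * i + 1).factorial +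
        ((2 - y) * t) ^ (2 * i + 1) / (2 * i + 1).factorial +
        4 * ((y * t) ^ (2 * i + 1) / (2 * i + 1).factorial) -
      ((y + 4) * (t ^ (2 * i + 1) / (2 * i + 1).factorial) +
        y * ((3 * t) ^ (2 * i + 1) / (2 * i + 1).factorial)) =
      ((y + 2) ^ (2 * i + 1) + (2 - y) ^ (2 * i + 1) + 4 * y ^ (2 * i + 1) -
        (y + 4 + y * 3 ^ (2 * i + 1))) * (t ^ (2 * i + 1) / (2 * i + 1).factorial) := by
    simp only [mul_pow]
    ring
  simpa only [e] using h

theorem sinh_combination_nonneg {y t : ℝ} (hy : 1 ≤ y) (ht : 0 ≤ t) :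
    (y + 4) * Real.sinh t + y * Real.sinh (3 * t) ≤
      Real.sinh ((y + 2) * t) + Real.sinh ((2 - y) * t) + 4 * Real.sinh (y * t) :=
  sub_nonneg.1 <| (hasSum_sinh_combination y t).nonneg fun i =>
    mul_nonneg (sub_nonneg.2 (sinh_coeff_nonneg hy i)) (by positivity)

theorem sinh_combination_nonpos {y t : ℝ} (hy : 3 / 5 ≤ y) (hy1 : y ≤ 1)
    (hq : 0 ≤ y ^ 2 + 4 * y - 3) (ht : 0 ≤ t) :
    Real.sinh ((y + 2) * t) + Real.sinh ((2 - y) * t) + 4 * Real.sinh (y * t) ≤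
      (y + 4) * Real.sinh t + y * Real.sinh (3 * t) :=
  sub_nonpos.1 <| (hasSum_sinh_combination y t).nonpos fun i =>
    mul_nonpos_of_nonpos_of_nonneg (sub_nonpos.2 (sinh_coeff_nonpos hy hy1 hq i)) (by positivity)

/-! ### Monotonicity of the slope -/

/-- The derivative (up to a positive factor) of the Rényi entropy of a qubit with respect to the
concurrence `1 / cosh t`. -/
noncomputable def renyiSlope (α t : ℝ) : ℝ :=
  if α = 1 then t / Real.sinh t
  else α / (α - 1) * (Real.sinh ((α - 1) * t) * Real.cosh t / (Real.cosh (α * t) * Real.sinh t))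

/-- The bracket on the left is the numerator of the derivative of the quotient in `renyiSlope`;
product-to-sum formulas turn it into the sinh combination at y = 2α - 1. In terms of e^t and e^{αt}
the identity is rational. -/
theorem wronskian_identity (α t : ℝ) :
    8 * (((α - 1) * Real.cosh ((α - 1) * t) * Real.cosh t +
          Real.sinh ((α - 1) * t) * Real.sinh t) * (Real.cosh (α * t) * Real.sinh t) -
        Real.sinh ((α - 1) * t) * Real.cosh t *
          (α * Real.sinh (α * t) * Real.sinh t + Real.cosh (α * t) * Real.cosh t)) =
      -(Real.sinh ((2 * α - 1 + 2) * t) + Real.sinh ((2 - (2 * α - 1)) * t) +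
          4 * Real.sinh ((2 * α - 1) * t) -
        ((2 * α - 1 + 4) * Real.sinh t + (2 * α - 1) * Real.sinh (3 * t))) := by
  have e1 : (α - 1) * t = α * t - t := by ring
  have e2 : (2 * α - 1 + 2) * t = α * t + α * t + t := by ring
  have e3 : (2 - (2 * α - 1)) * t = t + t + t - (α * t + α * t) := by ring
  have e4 : (2 * α - 1) * t = α * t + α * t - t := by ring
  have e5 : 3 * t = t + t + t := by ring
  rw [e1, e2, e3, e4, e5]
  simp only [Real.sinh_add, Real.sinh_sub, Real.cosh_add, Real.cosh_sub]
  simp only [Real.cosh_eq, Real.sinh_eq, Real.exp_neg]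
  have h1 := (Real.exp_pos t).ne'
  have h2 := (Real.exp_pos (α * t)).ne'
  generalize Real.exp (α * t) = A at *
  generalize Real.exp t = B at *
  field_simp
  ring

theorem antitoneOn_id_div_sinh : AntitoneOn (fun t : ℝ => t / Real.sinh t) (Ioi 0) := by
  have hd : ∀ t ∈ Ioi (0 : ℝ), HasDerivAt (fun t : ℝ => t / Real.sinh t)
      ((1 * Real.sinh t - t * Real.cosh t) / Real.sinh t ^ 2) t := fun t ht =>
    (hasDerivAt_id t).div (Real.hasDerivAt_sinh t) (Real.sinh_pos_iff.2 ht).ne'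
  refine antitoneOn_of_deriv_nonpos (convex_Ioi 0)
    (fun t ht => (hd t ht).continuousAt.continuousWithinAt)
    (fun t ht => (hd t (interior_subset ht)).differentiableAt.differentiableWithinAt)
    fun t ht => ?_
  have ht' : 0 < t := interior_subset ht
  rw [(hd t ht').deriv]
  refine div_nonpos_of_nonpos_of_nonneg ?_ (sq_nonneg _)
  have hmono : MonotoneOn (fun t : ℝ => t * Real.cosh t - Real.sinh t) (Ici 0) := by
    have hd' : ∀ t : ℝ, HasDerivAt (fun t : ℝ => t * Real.cosh t - Real.sinh t)
        (1 * Real.cosh t + t * Real.sinh t - Real.cosh t) t := fun t =>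
      ((hasDerivAt_id t).mul (Real.hasDerivAt_cosh t)).sub (Real.hasDerivAt_sinh t)
    refine monotoneOn_of_deriv_nonneg (convex_Ici 0)
      (fun t _ => (hd' t).continuousAt.continuousWithinAt)
      (fun t _ => (hd' t).differentiableAt.differentiableWithinAt) fun t ht => ?_
    have ht' : 0 ≤ t := interior_subset ht
    rw [(hd' t).deriv]
    nlinarith [mul_nonneg ht' (Real.sinh_nonneg_iff.2 ht')]
  have := hmono (mem_Ici.2 le_rfl) (mem_Ici.2 ht'.le) ht'.le
  simp at this
  linarith

theorem renyiSlope_antitoneOn {α : ℝ} (hα : (Real.sqrt 7 - 1) / 2 ≤ α) :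
    AntitoneOn (renyiSlope α) (Ioi 0) := by
  have h7 : (13 : ℝ) / 5 ≤ Real.sqrt 7 := Real.le_sqrt_of_sq_le (by norm_num)
  have hs7 : Real.sqrt 7 ^ 2 = 7 := Real.sq_sqrt (by norm_num)
  by_cases h1 : α = 1
  · have : renyiSlope α = fun t : ℝ => t / Real.sinh t := by
      ext t; simp [renyiSlope, h1]
    rw [this]
    exact antitoneOn_id_div_sinh
  have hα0 : 0 < α := by linarith
  have hne : α - 1 ≠ 0 := sub_ne_zero.2 h1
  have heq : renyiSlope α = fun t : ℝ => α / (α - 1) *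
      (Real.sinh ((α - 1) * t) * Real.cosh t / (Real.cosh (α * t) * Real.sinh t)) := by
    ext t; simp [renyiSlope, h1]
  rw [heq]
  have hd : ∀ t ∈ Ioi (0 : ℝ), HasDerivAt (fun t : ℝ => α / (α - 1) *
      (Real.sinh ((α - 1) * t) * Real.cosh t / (Real.cosh (α * t) * Real.sinh t)))
      (α / (α - 1) * ((((α - 1) * Real.cosh ((α - 1) * t) * Real.cosh t +
          Real.sinh ((α - 1) * t) * Real.sinh t) * (Real.cosh (α * t) * Real.sinh t) -
        Real.sinh ((α - 1) * t) * Real.cosh t *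
          (α * Real.sinh (α * t) * Real.sinh t + Real.cosh (α * t) * Real.cosh t)) /
        (Real.cosh (α * t) * Real.sinh t) ^ 2)) t := by
    intro t ht
    have i1 : HasDerivAt (fun t : ℝ => Real.sinh ((α - 1) * t))
        ((α - 1) * Real.cosh ((α - 1) * t)) t := by
      simpa [mul_comm] using ((hasDerivAt_id t).const_mul (α - 1)).sinh
    have i2 : HasDerivAt (fun t : ℝ => Real.cosh (α * t)) (α * Real.sinh (α * t)) t := by
      simpa [mul_comm] using ((hasDerivAt_id t).const_mul α).cosh
    exact ((i1.mul (Real.hasDerivAt_cosh t)).div (i2.mul (Real.hasDerivAt_sinh t))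
      (mul_pos (Real.cosh_pos _) (Real.sinh_pos_iff.2 ht)).ne').const_mul _
  refine antitoneOn_of_deriv_nonpos (convex_Ioi 0)
    (fun t ht => (hd t ht).continuousAt.continuousWithinAt)
    (fun t ht => (hd t (interior_subset ht)).differentiableAt.differentiableWithinAt)
    fun t ht => ?_
  have ht' : 0 < t := interior_subset ht
  rw [(hd t ht').deriv]
  have hw := wronskian_identity α t
  -- The prefactor α/(α - 1) and the sinh combination change sign together at α = 1. Below 1 the
  -- condition y² + 4y - 3 ≥ 0 reads (2α + 1)² ≥ 7.
  rcases lt_or_gt_of_ne h1 with hlt | hgt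
  · have hG := sinh_combination_nonpos (y := 2 * α - 1) (t := t) (by linarith) (by linarith)
      (by nlinarith) ht'.le
    exact mul_nonpos_of_nonpos_of_nonneg
      (div_nonpos_of_nonneg_of_nonpos hα0.le (by linarith))
      (div_nonneg (by linarith) (sq_nonneg _))
  · have hG := sinh_combination_nonneg (y := 2 * α - 1) (t := t) (by linarith) ht'.le
    exact mul_nonpos_of_nonneg_of_nonpos
      (div_nonneg hα0.le (by linarith))
      (div_nonpos_of_nonpos_of_nonneg (by linarith) (sq_nonneg _))

/-! ### Rényi entropy as a convex function of the concurrence -/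

/-- The Rényi-`α` entropy of a spectrum `{p, q}`. -/
noncomputable def binaryRenyi (α p q : ℝ) : ℝ :=
  if α = 1 then -(p * Real.logb 2 p + q * Real.logb 2 q)
  else 1 / (1 - α) * Real.logb 2 (p ^ α + q ^ α)

/-- The Rényi-`α` entanglement of a pure state of Schmidt rank at most two, as a function of its
concurrence. -/
noncomputable def renyiOfConcurrence (α x : ℝ) : ℝ :=
  binaryRenyi α ((1 + Real.sqrt (1 - x ^ 2)) / 2) ((1 - Real.sqrt (1 - x ^ 2)) / 2)

theorem binaryRenyi_nonneg {α p q : ℝ} (hα : 0 < α) (hp : 0 ≤ p) (hq : 0 ≤ q) (hpq : p + q = 1) :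
    0 ≤ binaryRenyi α p q := by
  have hp1 : p ≤ 1 := by linarith
  have hq1 : q ≤ 1 := by linarith
  unfold binaryRenyi
  split_ifs with h
  · have := mul_nonpos_of_nonneg_of_nonpos hp (Real.logb_nonpos one_lt_two hp hp1)
    have := mul_nonpos_of_nonneg_of_nonpos hq (Real.logb_nonpos one_lt_two hq hq1)
    linarith
  · rcases lt_or_gt_of_ne h with hlt | hgt
    · refine mul_nonneg (one_div_nonneg.2 (by linarith)) (Real.logb_nonneg one_lt_two ?_)
      have := Real.rpow_le_rpow_of_exponent_ge' hp hp1 hα.le hlt.le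
      have := Real.rpow_le_rpow_of_exponent_ge' hq hq1 hα.le hlt.le
      simp only [Real.rpow_one] at *
      linarith
    · refine mul_nonneg_of_nonpos_of_nonpos (one_div_nonpos.2 (by linarith))
        (Real.logb_nonpos one_lt_two (by positivity) ?_)
      have := Real.rpow_le_rpow_of_exponent_ge' hp hp1 zero_le_one hgt.le
      have := Real.rpow_le_rpow_of_exponent_ge' hq hq1 zero_le_one hgt.le
      simp only [Real.rpow_one] at *
      linarith

theorem binaryRenyi_comm (α p q : ℝ) : binaryRenyi α p q = binaryRenyi α q p := by
  unfold binaryRenyi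
  split_ifs <;> simp [add_comm]

theorem renyiOfConcurrence_nonneg {α : ℝ} (hα : 0 < α) (x : ℝ) : 0 ≤ renyiOfConcurrence α x := by
  have h : Real.sqrt (1 - x ^ 2) ≤ 1 := Real.sqrt_le_one.2 (by nlinarith [sq_nonneg x])
  have h0 := Real.sqrt_nonneg (1 - x ^ 2)
  exact binaryRenyi_nonneg hα (by linarith) (by linarith) (by ring)

theorem renyiOfConcurrence_zero {α : ℝ} (hα : 0 < α) : renyiOfConcurrence α 0 = 0 := by
  simp [renyiOfConcurrence, binaryRenyi, Real.zero_rpow hα.ne']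

theorem continuousOn_renyiOfConcurrence {α : ℝ} (hα : 0 < α) :
    ContinuousOn (renyiOfConcurrence α) (Icc 0 1) := by
  by_cases h1 : α = 1
  · have : renyiOfConcurrence α = fun x =>
        (Real.negMulLog ((1 + Real.sqrt (1 - x ^ 2)) / 2) +
          Real.negMulLog ((1 - Real.sqrt (1 - x ^ 2)) / 2)) / Real.log 2 := by
      ext x
      simp only [renyiOfConcurrence, binaryRenyi, h1, if_true, Real.negMulLog, Real.logb]
      ring
    rw [this]
    fun_prop
  · have : renyiOfConcurrence α = fun x => 1 / (1 - α) * (Real.log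
        (((1 + Real.sqrt (1 - x ^ 2)) / 2) ^ α + ((1 - Real.sqrt (1 - x ^ 2)) / 2) ^ α)
          / Real.log 2) := by
      ext x
      simp only [renyiOfConcurrence, binaryRenyi, h1, if_false, Real.logb]
    rw [this]
    refine ContinuousOn.mul continuousOn_const (ContinuousOn.div_const (ContinuousOn.log ?_ ?_) _)
    · refine ContinuousOn.add ?_ ?_ <;>
      exact ContinuousOn.rpow_const (by fun_prop) fun _ _ => Or.inr hα.le
    · intro x _
      have h : Real.sqrt (1 - x ^ 2) ≤ 1 := Real.sqrt_le_one.2 (by nlinarith [sq_nonneg x])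
      have h0 := Real.sqrt_nonneg (1 - x ^ 2)
      have := Real.rpow_pos_of_pos (by linarith : 0 < (1 + Real.sqrt (1 - x ^ 2)) / 2) α
      have := Real.rpow_nonneg (by linarith : 0 ≤ (1 - Real.sqrt (1 - x ^ 2)) / 2) α
      linarith

/-- `renyiOfConcurrence` in the parametrization `x = 1 / cosh t`, in nats. -/
noncomputable def renyiHyperbolic (α t : ℝ) : ℝ :=
  if α = 1 then Real.log (2 * Real.cosh t) - t * (Real.sinh t / Real.cosh t)
  else (Real.log (2 * Real.cosh (α * t)) - α * Real.log (2 * Real.cosh t)) / (1 - α)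

theorem renyiOfConcurrence_inv_cosh (α : ℝ) {t : ℝ} (ht : 0 ≤ t) :
    renyiOfConcurrence α (Real.cosh t)⁻¹ = renyiHyperbolic α t / Real.log 2 := by
  have hc := Real.cosh_pos t
  have hsq : Real.sqrt (1 - (Real.cosh t)⁻¹ ^ 2) = Real.sinh t / Real.cosh t := by
    rw [show 1 - (Real.cosh t)⁻¹ ^ 2 = (Real.sinh t / Real.cosh t) ^ 2 by
      field_simp; rw [Real.cosh_sq]; ring]
    exact Real.sqrt_sq (div_nonneg (Real.sinh_nonneg_iff.2 ht) hc.le)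
  have hp : (1 + Real.sinh t / Real.cosh t) / 2 = Real.exp t / (2 * Real.cosh t) := by
    rw [← Real.cosh_add_sinh]; field_simp
  have hq : (1 - Real.sinh t / Real.cosh t) / 2 = Real.exp (-t) / (2 * Real.cosh t) := by
    rw [← Real.cosh_sub_sinh]; field_simp
  have h2c : 0 < 2 * Real.cosh t := by positivity
  unfold renyiOfConcurrence binaryRenyi renyiHyperbolic
  rw [hsq, hp, hq]
  split_ifs with h
  · simp only [Real.logb]
    rw [Real.log_div (Real.exp_pos _).ne' h2c.ne', Real.log_div (Real.exp_pos _).ne' h2c.ne',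
      Real.log_exp, Real.log_exp]
    rw [Real.sinh_eq]
    have : Real.exp t + Real.exp (-t) = 2 * Real.cosh t := by rw [Real.cosh_eq]; ring
    have hl : Real.log 2 ≠ 0 := (Real.log_pos one_lt_two).ne'
    field_simp
    linear_combination Real.log (2 * Real.cosh t) * this
  · rw [Real.div_rpow (Real.exp_pos _).le h2c.le, Real.div_rpow (Real.exp_pos _).le h2c.le,
      ← add_div, ← Real.exp_mul, ← Real.exp_mul]
    have : Real.exp (t * α) + Real.exp (-t * α) = 2 * Real.cosh (α * t) := by
      rw [Real.cosh_eq]; ring_nf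
    rw [this, Real.logb, Real.log_div (by positivity) (by positivity), Real.log_rpow h2c]
    ring

/-- For x = 1/cosh t one has dx/dt = -sinh t / cosh² t, so the factor `renyiSlope α t` is the
derivative in x, in nats. -/
theorem hasDerivAt_renyiHyperbolic (α : ℝ) {t : ℝ} (ht : 0 < t) :
    HasDerivAt (renyiHyperbolic α)
      (-(renyiSlope α t * (Real.sinh t / Real.cosh t ^ 2))) t := by
  have hc := Real.cosh_pos t
  have hs := Real.sinh_pos_iff.2 ht
  have l1 : HasDerivAt (fun t => Real.log (2 * Real.cosh t)) (2 * Real.sinh t / (2 * Real.cosh t)) t :=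
    ((Real.hasDerivAt_cosh t).const_mul 2).log (by positivity)
  by_cases h1 : α = 1
  · have e : renyiHyperbolic α = fun t => Real.log (2 * Real.cosh t) -
        t * (Real.sinh t / Real.cosh t) := by
      ext t; simp [renyiHyperbolic, h1]
    rw [e]
    refine HasDerivAt.congr_deriv (l1.sub ((hasDerivAt_id t).mul
      ((Real.hasDerivAt_sinh t).div (Real.hasDerivAt_cosh t) hc.ne'))) ?_
    simp only [renyiSlope, h1, if_true, id]
    field_simp
    rw [Real.cosh_sq]
    ring
  · have e : renyiHyperbolic α = fun t =>
        (Real.log (2 * Real.cosh (α * t)) - α * Real.log (2 * Real.cosh t)) / (1 - α) := by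
      ext t; simp [renyiHyperbolic, h1]
    rw [e]
    have hca := Real.cosh_pos (α * t)
    have i2 : HasDerivAt (fun t : ℝ => Real.cosh (α * t)) (α * Real.sinh (α * t)) t := by
      simpa [mul_comm] using ((hasDerivAt_id t).const_mul α).cosh
    have l2 := (i2.const_mul 2).log (by positivity)
    refine ((l2.sub (l1.const_mul α)).div_const (1 - α)).congr_deriv ?_
    simp only [renyiSlope, h1, if_false]
    rw [show (α - 1) * t = α * t - t by ring, Real.sinh_sub]
    have n1 : α - 1 ≠ 0 := sub_ne_zero.2 h1
    have n2 : 1 - α ≠ 0 := sub_ne_zero.2 (Ne.symm h1)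
    field_simp
    ring

theorem hasDerivAt_renyiOfConcurrence (α : ℝ) {x : ℝ} (hx : x ∈ Ioo (0 : ℝ) 1) :
    HasDerivAt (renyiOfConcurrence α) (renyiSlope α (Real.arcosh x⁻¹) / Real.log 2) x := by
  obtain ⟨hx0, hx1⟩ := hx
  have h1 : 1 < x⁻¹ := (one_lt_inv₀ hx0).2 hx1
  have hθ := Real.arcosh_pos h1
  have hd := ((hasDerivAt_renyiHyperbolic α hθ).comp x
    ((Real.hasDerivAt_arcosh (mem_Ioi.2 h1)).comp x (hasDerivAt_inv hx0.ne'))).div_const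
      (Real.log 2)
  have hev : renyiOfConcurrence α =ᶠ[nhds x]
      fun y => (renyiHyperbolic α ∘ Real.arcosh ∘ Inv.inv) y / Real.log 2 := by
    filter_upwards [Ioo_mem_nhds hx0 hx1] with y hy
    have hy1 : 1 ≤ y⁻¹ := ((one_lt_inv₀ hy.1).2 hy.2).le
    have := renyiOfConcurrence_inv_cosh α (Real.arcosh_nonneg hy1)
    rw [Real.cosh_arcosh hy1, inv_inv] at this
    exact this
  refine (hd.congr_of_eventuallyEq hev).congr_deriv ?_
  have hs := Real.sinh_pos_iff.2 hθ
  rw [← Real.sinh_arcosh h1.le, Real.cosh_arcosh h1.le]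
  generalize Real.arcosh x⁻¹ = θ at *
  field_simp

/-- The derivative at x is the slope at t = arcosh(1/x) up to log 2; t decreases in x and the slope
decreases in t. -/
theorem convexOn_renyiOfConcurrence {α : ℝ} (hα : (Real.sqrt 7 - 1) / 2 ≤ α) :
    ConvexOn ℝ (Icc 0 1) (renyiOfConcurrence α) := by
  have h7 : (13 : ℝ) / 5 ≤ Real.sqrt 7 := Real.le_sqrt_of_sq_le (by norm_num)
  refine MonotoneOn.convexOn_of_deriv (convex_Icc 0 1)
    (continuousOn_renyiOfConcurrence (by linarith)) ?_ ?_
  · rw [interior_Icc]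
    exact fun x hx =>
      (hasDerivAt_renyiOfConcurrence α hx).differentiableAt.differentiableWithinAt
  · rw [interior_Icc]
    intro x hx y hy hxy
    rw [(hasDerivAt_renyiOfConcurrence α hx).deriv, (hasDerivAt_renyiOfConcurrence α hy).deriv]
    have hx1 : 1 < x⁻¹ := (one_lt_inv₀ hx.1).2 hx.2
    have hy1 : 1 < y⁻¹ := (one_lt_inv₀ hy.1).2 hy.2
    exact div_le_div_of_nonneg_right (renyiSlope_antitoneOn hα (Real.arcosh_pos hy1)
      (Real.arcosh_pos hx1) ((Real.arcosh_le_arcosh (by linarith) (by linarith)).2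
        ((inv_le_inv₀ hy.1 hx.1).2 hxy))) (Real.log_pos one_lt_two).le

/-! ### Density matrices of rank at most two -/

/-- One pair, padded by zeros if necessary, serves trace, purity and entropy at once, since each
sums a function vanishing at 0 over the spectrum. -/
theorem exists_pair_forall_sum_eq {ι : Type*} [Fintype ι] [DecidableEq ι] (l : ι → ℝ)
    (hl : Fintype.card {i // l i ≠ 0} ≤ 2) :
    ∃ p q : ℝ, ∀ g : ℝ → ℝ, g 0 = 0 → ∑ i, g (l i) = g p + g q := by
  set S : Finset ι := Finset.univ.filter fun i => l i ≠ 0 with hS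
  have hcard : S.card ≤ 2 := by rwa [Fintype.card_subtype] at hl
  have hsum (g : ℝ → ℝ) (hg : g 0 = 0) : ∑ i, g (l i) = ∑ i ∈ S, g (l i) := by
    refine (Finset.sum_subset (Finset.subset_univ S) fun i _ hi => ?_).symm
    have : l i = 0 := by simpa [hS] using hi
    rw [this, hg]
  interval_cases h : S.card
  · refine ⟨0, 0, fun g hg => ?_⟩
    rw [hsum g hg, Finset.card_eq_zero.1 h]
    simp [hg]
  · obtain ⟨i, hi⟩ := Finset.card_eq_one.1 h
    refine ⟨l i, 0, fun g hg => ?_⟩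
    rw [hsum g hg, hi]
    simp [hg]
  · obtain ⟨i, j, hij, hi⟩ := Finset.card_eq_two.1 h
    refine ⟨l i, l j, fun g hg => ?_⟩
    rw [hsum g hg, hi, Finset.sum_pair hij]

theorem sum_eigenvalues_sq {ι : Type*} [Fintype ι] [DecidableEq ι] {A : Matrix ι ι ℂ}
    (hA : A.IsHermitian) : ((∑ i, hA.eigenvalues i ^ 2 : ℝ) : ℂ) = (A * A).trace := by
  have h := hA.spectral_theorem
  set D : Matrix ι ι ℂ := Matrix.diagonal (RCLike.ofReal ∘ hA.eigenvalues)
  have h2 : A * A = Unitary.conjStarAlgAut ℂ (Matrix ι ι ℂ) hA.eigenvectorUnitary (D * D) := by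
    rw [map_mul, ← h]
  rw [h2, Unitary.conjStarAlgAut_apply, Matrix.trace_mul_cycle]
  simp [D, Matrix.trace, pow_two]

theorem rank_add_le {ι : Type*} [Fintype ι] (A B : Matrix ι ι ℂ) :
    (A + B).rank ≤ A.rank + B.rank := by
  unfold Matrix.rank
  rw [Matrix.mulVecLin_add]
  refine (Submodule.finrank_mono (LinearMap.range_add_le _ _)).trans ?_
  exact Submodule.finrank_add_le_finrank_add_finrank _ _

/-- Trace and purity fix the two eigenvalues up to order: (p - q)² = 2(p² + q²) - (p + q)² = 1 - C².
-/
theorem renyiEntropy_eq_renyiOfConcurrence {ι : Type*} [Fintype ι] [DecidableEq ι] {A : Matrix ι ι ℂ}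
    (hA : A.IsHermitian) {α : ℝ} (hα : 0 < α) (hrank : A.rank ≤ 2) (htr : A.trace = 1) {C : ℝ}
    (htr2 : (A * A).trace = ((1 - C ^ 2 / 2 : ℝ) : ℂ)) :
    renyiEntropy α A hA = renyiOfConcurrence α C := by
  rw [hA.rank_eq_card_non_zero_eigs] at hrank
  obtain ⟨p, q, hpq⟩ := exists_pair_forall_sum_eq hA.eigenvalues hrank
  have e1 : p + q = 1 := by
    rw [← show ∑ i, hA.eigenvalues i = p + q from hpq id rfl]
    have h : ((∑ i, hA.eigenvalues i : ℝ) : ℂ) = 1 := by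
      rw [← htr, hA.trace_eq_sum_eigenvalues]
      push_cast
      rfl
    exact_mod_cast h
  have e2 : p ^ 2 + q ^ 2 = 1 - C ^ 2 / 2 := by
    rw [← show _ = p ^ 2 + q ^ 2 from hpq (fun x => x ^ 2) (by simp)]
    rw [← sum_eigenvalues_sq hA] at htr2
    exact_mod_cast htr2
  have key : renyiEntropy α A hA = binaryRenyi α p q := by
    unfold renyiEntropy binaryRenyi
    rw [hpq (fun x => x * Real.logb 2 x) (by simp),
      hpq (fun x => x ^ α) (Real.zero_rpow hα.ne')]
  have hC : 1 - C ^ 2 = (p - q) ^ 2 := by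
    have : q = 1 - p := by linarith
    subst this
    linarith
  rw [key, renyiOfConcurrence, hC, Real.sqrt_sq_eq_abs]
  rcases abs_cases (p - q) with ⟨h, _⟩ | ⟨h, _⟩
  · rw [h]
    congr 1 <;> linarith
  · rw [h, binaryRenyi_comm]
    congr 1 <;> linarith

/-! ### Pure states supported on a cross -/

/-- The weight of `φ` on the product basis vectors `(i, j₀)` with `i ≠ i₀`. -/
noncomputable def leftWeight {a b : Type*} [Fintype a] [DecidableEq a] (i₀ : a) (j₀ : b) (φ : a × b → ℂ) : ℝ :=
  ∑ i ∈ Finset.univ.erase i₀, ‖φ (i, j₀)‖ ^ 2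

/-- The weight of `φ` on the product basis vectors `(i₀, j)` with `j ≠ j₀`. -/
noncomputable def rightWeight {a b : Type*} [Fintype b] [DecidableEq b] (i₀ : a) (j₀ : b) (φ : a × b → ℂ) : ℝ :=
  ∑ j ∈ Finset.univ.erase j₀, ‖φ (i₀, j)‖ ^ 2

theorem leftWeight_nonneg {a b : Type*} [Fintype a] [DecidableEq a] (i₀ : a) (j₀ : b) (φ : a × b → ℂ) : 0 ≤ leftWeight i₀ j₀ φ :=
  Finset.sum_nonneg fun _ _ => sq_nonneg _

theorem rightWeight_nonneg {a b : Type*} [Fintype b] [DecidableEq b] (i₀ : a) (j₀ : b) (φ : a × b → ℂ) : 0 ≤ rightWeight i₀ j₀ φ :=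
  Finset.sum_nonneg fun _ _ => sq_nonneg _

theorem sum_normSq_of_cross {a b : Type*} [Fintype a] [Fintype b] [DecidableEq a] [DecidableEq b]
    {i₀ : a} {j₀ : b} {φ : a × b → ℂ} (hφ : ∀ i ≠ i₀, ∀ j ≠ j₀, φ (i, j) = 0) :
    ∑ x, ‖φ x‖ ^ 2 = ‖φ (i₀, j₀)‖ ^ 2 + leftWeight i₀ j₀ φ + rightWeight i₀ j₀ φ := by
  rw [Fintype.sum_prod_type, ← Finset.add_sum_erase _ _ (Finset.mem_univ i₀),
    ← Finset.add_sum_erase _ _ (Finset.mem_univ j₀)]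
  have : ∑ i ∈ Finset.univ.erase i₀, ∑ j, ‖φ (i, j)‖ ^ 2 = leftWeight i₀ j₀ φ := by
    refine Finset.sum_congr rfl fun i hi => ?_
    rw [Finset.sum_eq_single j₀]
    · intro j _ hj
      simp [hφ i (Finset.ne_of_mem_erase hi) j hj]
    · simp
  rw [this, rightWeight]
  ring

/-- Each column other than `j₀` is a multiple of the basis vector at `i₀`, so all of them together
contribute a single rank-one term. -/
theorem reducedLeft_of_cross {a b : Type*} [Fintype b] [DecidableEq a] [DecidableEq b]
    {i₀ : a} {j₀ : b} {φ : a × b → ℂ} (hφ : ∀ i ≠ i₀, ∀ j ≠ j₀, φ (i, j) = 0) :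
    reducedLeft φ = Matrix.vecMulVec (fun i => φ (i, j₀)) (star fun i => φ (i, j₀)) +
      Matrix.vecMulVec ((rightWeight i₀ j₀ φ : ℂ) • Pi.single i₀ 1) (Pi.single i₀ 1) := by
  ext i i'
  simp only [reducedLeft, Matrix.add_apply, Matrix.vecMulVec_apply, Pi.star_apply, Pi.smul_apply,
    smul_eq_mul]
  rw [← Finset.add_sum_erase _ _ (Finset.mem_univ j₀)]
  congr 1
  by_cases hi : i = i₀
  · by_cases hi' : i' = i₀
    · subst hi hi'
      simp [rightWeight, Complex.mul_conj, Complex.normSq_eq_norm_sq]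
    · rw [Pi.single_eq_of_ne hi', mul_zero]
      exact Finset.sum_eq_zero fun j hj => by simp [hφ i' hi' j (Finset.ne_of_mem_erase hj)]
  · rw [Pi.single_eq_of_ne hi, mul_zero, zero_mul]
    exact Finset.sum_eq_zero fun j hj => by simp [hφ i hi j (Finset.ne_of_mem_erase hj)]

theorem two_mul_sqrt_mul_le_one {x y : ℝ} (hx : 0 ≤ x) (hy : 0 ≤ y) (h : x + y ≤ 1) :
    2 * Real.sqrt (x * y) ≤ 1 := by
  have : Real.sqrt (x * y) ≤ 1 / 2 :=
    Real.sqrt_le_iff.2 ⟨by norm_num, by nlinarith [sq_nonneg (x - y)]⟩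
  linarith

/-- With left weight A and right weight B the purity is (1 - B)² + B² + 2B(1 - A - B) = 1 - 2AB,
that is, C² = 4AB. -/
theorem pureRenyiEntanglement_of_cross {a b : Type*} [Fintype a] [Fintype b] [DecidableEq a] [DecidableEq b]
    {i₀ : a} {j₀ : b} {φ : a × b → ℂ}
    (hφ : ∀ i ≠ i₀, ∀ j ≠ j₀, φ (i, j) = 0) (hnorm : ∑ x, ‖φ x‖ ^ 2 = 1) {α : ℝ} (hα : 0 < α) :
    pureRenyiEntanglement α φ =
      renyiOfConcurrence α (2 * Real.sqrt (leftWeight i₀ j₀ φ * rightWeight i₀ j₀ φ)) := by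
  rw [sum_normSq_of_cross hφ] at hnorm
  have hA := leftWeight_nonneg i₀ j₀ φ
  have hB := rightWeight_nonneg i₀ j₀ φ
  set A := leftWeight i₀ j₀ φ with hAdef
  set B := rightWeight i₀ j₀ φ with hBdef
  have hred := reducedLeft_of_cross hφ
  rw [← hBdef] at hred
  set u : a → ℂ := fun i => φ (i, j₀) with hudef
  have hu : u ⬝ᵥ star u = ((1 - B : ℝ) : ℂ) := by
    have : 1 - B = ∑ i, ‖φ (i, j₀)‖ ^ 2 := by
      rw [← Finset.add_sum_erase _ (fun i => ‖φ (i, j₀)‖ ^ 2) (Finset.mem_univ i₀)]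
      linarith [show A = ∑ i ∈ Finset.univ.erase i₀, ‖φ (i, j₀)‖ ^ 2 from rfl]
    rw [this]
    simp [dotProduct, hudef, Complex.mul_conj, Complex.normSq_eq_norm_sq]
  have h0 : u i₀ * star (u i₀) = ((1 - A - B : ℝ) : ℂ) := by
    rw [show 1 - A - B = ‖φ (i₀, j₀)‖ ^ 2 by linarith]
    simp [hudef, Complex.mul_conj, Complex.normSq_eq_norm_sq]
  refine renyiEntropy_eq_renyiOfConcurrence _ hα ?_ ?_ ?_
  · rw [hred]
    refine (rank_add_le _ _).trans ?_
    exact add_le_add (Matrix.rank_vecMulVec_le _ _) (Matrix.rank_vecMulVec_le _ _)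
  · rw [hred]
    simp only [Matrix.trace_add, Matrix.trace_vecMulVec, hu, smul_dotProduct,
      single_dotProduct, Pi.single_eq_same]
    simp
  · rw [hred, mul_pow, Real.sq_sqrt (mul_nonneg hA hB)]
    simp only [Matrix.add_mul, Matrix.mul_add, Matrix.vecMulVec_mul_vecMulVec,
      Matrix.trace_add, Matrix.trace_vecMulVec, smul_dotProduct, dotProduct_smul,
      single_dotProduct, dotProduct_single, Pi.single_eq_same, dotProduct_comm (star u) u, hu,
      Pi.star_apply, Pi.smul_apply, smul_eq_mul, mul_one, one_mul]
    push_cast at h0 ⊢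
    linear_combination 2 * (B : ℂ) * h0

/-! ### Pure state decompositions and the convex roof -/

/-- If `∑ q_k |φ_k⟩⟨φ_k|` and `|x⟩⟨x|` have the same entries off the index `z₀`, then off `z₀`
every `φ_k` of positive weight is a multiple of `x`. -/
theorem exists_coeff_of_sum_eq {ι : Type*} {m : ℕ} {q : Fin m → ℝ} (hq : ∀ k, 0 ≤ q k)
    (hq1 : ∑ k, q k = 1) {φ : Fin m → ι → ℂ} {x : ι → ℂ} {z₀ : ι}
    (h : ∀ z ≠ z₀, ∀ z' ≠ z₀, ∑ k, (q k : ℂ) * (φ k z * star (φ k z')) = x z * star (x z')) :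
    ∃ c : Fin m → ℂ, ∑ k, q k * ‖c k‖ ^ 2 = 1 ∧
      ∀ k, q k ≠ 0 → ∀ z ≠ z₀, φ k z = c k * x z := by
  have hvanish (f : Fin m → ℂ) (hf : ∑ k, (q k : ℂ) * (f k * star (f k)) = 0) (k : Fin m)
      (hk : q k ≠ 0) : f k = 0 := by
    have h1 : ∑ k, q k * ‖f k‖ ^ 2 = 0 := by
      have : ((∑ k, q k * ‖f k‖ ^ 2 : ℝ) : ℂ) = 0 := by
        rw [← hf]
        simp [Complex.mul_conj, Complex.normSq_eq_norm_sq]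
      exact_mod_cast this
    have h2 := (Finset.sum_eq_zero_iff_of_nonneg
      (fun k _ => mul_nonneg (hq k) (sq_nonneg ‖f k‖))).1 h1 k (Finset.mem_univ k)
    simpa [hk] using h2
  by_cases hx : ∀ z ≠ z₀, x z = 0
  · refine ⟨fun _ => 1, by simpa using hq1, fun k hk z hz => ?_⟩
    rw [hx z hz, mul_zero]
    exact hvanish (fun k => φ k z) (by rw [h z hz z hz, hx z hz, zero_mul]) k hk
  · push Not at hx
    obtain ⟨w, hw, hxw⟩ := hx
    have hsw : star (x w) ≠ 0 := star_ne_zero.2 hxw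
    have hc : ∑ k, (q k : ℂ) * (φ k w / x w * star (φ k w / x w)) = 1 := by
      have e (k : Fin m) : (q k : ℂ) * (φ k w / x w * star (φ k w / x w)) =
          (q k : ℂ) * (φ k w * star (φ k w)) / (x w * star (x w)) := by
        rw [star_div₀]
        field_simp
      simp only [e, ← Finset.sum_div, h w hw w hw, div_self (mul_ne_zero hxw hsw)]
    refine ⟨fun k => φ k w / x w, ?_, fun k hk z hz => ?_⟩
    · have h2 : ((∑ k, q k * ‖φ k w / x w‖ ^ 2 : ℝ) : ℂ) = 1 := by
        rw [← hc]
        push_cast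
        refine Finset.sum_congr rfl fun k _ => ?_
        rw [← starRingEnd_apply, Complex.mul_conj, Complex.normSq_eq_norm_sq]
        push_cast
        rfl
      exact_mod_cast h2
    -- The weighted sum of the squared deviations from proportionality expands into terms all known
    -- from `h`, and these cancel.
    · refine sub_eq_zero.1 (hvanish (fun k => φ k z - φ k w / x w * x z) ?_ k hk)
      have e (k : Fin m) : (q k : ℂ) * ((φ k z - φ k w / x w * x z) *
          star (φ k z - φ k w / x w * x z)) =
          (q k : ℂ) * (φ k z * star (φ k z)) -
          star (x z) / star (x w) * ((q k : ℂ) * (φ k z * star (φ k w))) -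
          x z / x w * ((q k : ℂ) * (φ k w * star (φ k z))) +
          x z * star (x z) * ((q k : ℂ) * (φ k w / x w * star (φ k w / x w))) := by
        simp only [star_sub, star_mul', star_div₀]
        field_simp
        ring
      simp only [e, Finset.sum_add_distrib, Finset.sum_sub_distrib, ← Finset.mul_sum,
        h z hz z hz, h z hz w hw, h w hw z hz, hc]
      field_simp
      ring

theorem leftWeight_congr_mul {a b : Type*} [Fintype a] [DecidableEq a] {i₀ : a} {j₀ : b}
    {φ x : a × b → ℂ} {c : ℂ} (h : ∀ z ≠ (i₀, j₀), φ z = c * x z) :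
    leftWeight i₀ j₀ φ = ‖c‖ ^ 2 * leftWeight i₀ j₀ x := by
  simp only [leftWeight, Finset.mul_sum]
  refine Finset.sum_congr rfl fun i hi => ?_
  rw [h _ (by simpa using Finset.ne_of_mem_erase hi), norm_mul, mul_pow]

theorem rightWeight_congr_mul {a b : Type*} [Fintype b] [DecidableEq b] {i₀ : a} {j₀ : b}
    {φ x : a × b → ℂ} {c : ℂ} (h : ∀ z ≠ (i₀, j₀), φ z = c * x z) :
    rightWeight i₀ j₀ φ = ‖c‖ ^ 2 * rightWeight i₀ j₀ x := by
  simp only [rightWeight, Finset.mul_sum]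
  refine Finset.sum_congr rfl fun i hi => ?_
  rw [h _ (by simpa using Finset.ne_of_mem_erase hi), norm_mul, mul_pow]

section

variable {a b : Type*} [Fintype a] [Fintype b] [DecidableEq a] [DecidableEq b]

/-- Both weights of `φ k` are |c_k|² times those of `x`, hence so is its concurrence; as ∑ q_k
|c_k|² = 1, the mean concurrence is that of `x`, and Jensen applies. -/
theorem renyiOfConcurrence_le_average {i₀ : a} {j₀ : b} {x : a × b → ℂ}
    {ρ : Matrix (a × b) (a × b) ℂ} (hx : ∀ i ≠ i₀, ∀ j ≠ j₀, x (i, j) = 0)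
    (hρ : ∀ z ≠ (i₀, j₀), ∀ z' ≠ (i₀, j₀), ρ z z' = x z * star (x z'))
    {α : ℝ} (hα : (Real.sqrt 7 - 1) / 2 ≤ α) {m : ℕ} {q : Fin m → ℝ} {φ : Fin m → a × b → ℂ}
    (hd : IsPureDecomposition ρ q φ) :
    renyiOfConcurrence α (2 * Real.sqrt (leftWeight i₀ j₀ x * rightWeight i₀ j₀ x)) ≤
      ∑ k, q k * pureRenyiEntanglement α (φ k) := by
  have h7 : (13 : ℝ) / 5 ≤ Real.sqrt 7 := Real.le_sqrt_of_sq_le (by norm_num)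
  have hα0 : 0 < α := by linarith
  obtain ⟨hq, hq1, hφ, hdec⟩ := hd
  obtain ⟨c, hc1, hc⟩ := exists_coeff_of_sum_eq hq hq1 (φ := φ) (x := x) (z₀ := (i₀, j₀))
    fun z hz z' hz' => by
      rw [← hρ z hz z' hz', hdec, Matrix.sum_apply]
      simp [Matrix.vecMulVec_apply]
  set A := leftWeight i₀ j₀ x with hA
  set B := rightWeight i₀ j₀ x with hB
  -- Members of weight zero are unconstrained; the value 0 keeps them in the interval where
  -- convexity is known.
  set p : Fin m → ℝ := fun k => if q k = 0 then 0 else ‖c k‖ ^ 2 * (2 * Real.sqrt (A * B))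
    with hp
  have hcross (k : Fin m) (hk : q k ≠ 0) : ∀ i ≠ i₀, ∀ j ≠ j₀, φ k (i, j) = 0 := by
    intro i hi j hj
    rw [hc k hk _ (by simp [hi]), hx i hi j hj, mul_zero]
  have hpk (k : Fin m) (hk : q k ≠ 0) :
      p k = 2 * Real.sqrt (leftWeight i₀ j₀ (φ k) * rightWeight i₀ j₀ (φ k)) := by
    simp only [hp, hk, if_false]
    rw [leftWeight_congr_mul (hc k hk), rightWeight_congr_mul (hc k hk), ← hA, ← hB,
      show ‖c k‖ ^ 2 * A * (‖c k‖ ^ 2 * B) = (‖c k‖ ^ 2) ^ 2 * (A * B) by ring,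
      Real.sqrt_mul (sq_nonneg _), Real.sqrt_sq (sq_nonneg _)]
    ring
  have hmem (k : Fin m) : p k ∈ Icc (0 : ℝ) 1 := by
    by_cases hk : q k = 0
    · simp [hp, hk]
    · rw [hpk k hk]
      refine ⟨by positivity, two_mul_sqrt_mul_le_one (leftWeight_nonneg _ _ _)
        (rightWeight_nonneg _ _ _) ?_⟩
      have := sum_normSq_of_cross (hcross k hk)
      rw [hφ k] at this
      nlinarith [sq_nonneg ‖φ k (i₀, j₀)‖]
  have hsum : ∑ k, q k • p k = 2 * Real.sqrt (A * B) := by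
    rw [← one_mul (2 * Real.sqrt (A * B)), ← hc1, Finset.sum_mul]
    refine Finset.sum_congr rfl fun k _ => ?_
    by_cases hk : q k = 0 <;> simp [hp, hk, mul_assoc]
  rw [← hsum]
  refine ((convexOn_renyiOfConcurrence hα).map_sum_le (fun k _ => hq k) hq1
    fun k _ => hmem k).trans (le_of_eq (Finset.sum_congr rfl fun k _ => ?_))
  by_cases hk : q k = 0
  · simp [hk]
  · rw [smul_eq_mul, pureRenyiEntanglement_of_cross (hcross k hk) (hφ k) hα0, hpk k hk]

theorem exists_pureDecomposition {i₀ : a} {j₀ : b} {x : a × b → ℂ}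
    (hx : ∀ i ≠ i₀, ∀ j ≠ j₀, x (i, j) = 0) (hreal : (x (i₀, j₀)).im = 0) {c : ℝ} (hc : 0 ≤ c)
    (hnorm : ∑ z, ‖x z‖ ^ 2 + c = 1) {α : ℝ} (hα : 0 < α) :
    ∃ (q : Fin 2 → ℝ) (φ : Fin 2 → a × b → ℂ),
      IsPureDecomposition (Matrix.vecMulVec x (star x) +
        (c : ℂ) • Matrix.vecMulVec (Pi.single (i₀, j₀) 1) (Pi.single (i₀, j₀) 1)) q φ ∧
      ∑ k, q k * pureRenyiEntanglement α (φ k) =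
        renyiOfConcurrence α (2 * Real.sqrt (leftWeight i₀ j₀ x * rightWeight i₀ j₀ x)) := by
  set e : a × b → ℂ := Pi.single (i₀, j₀) 1 with he
  -- For s = ±1 the cross terms cancel in the equal mixture. The phase i, orthogonal to the real
  -- vacuum amplitude, gives both vectors norm 1; their weights off the vacuum are those of `x`.
  let φ (s : ℝ) : a × b → ℂ := x + (s * Real.sqrt c * Complex.I) • e
  have hoff (s : ℝ) : ∀ z ≠ (i₀, j₀), φ s z = 1 * x z := by
    intro z hz
    simp [φ, he, Pi.single_eq_of_ne hz]
  have hcross (s : ℝ) : ∀ i ≠ i₀, ∀ j ≠ j₀, φ s (i, j) = 0 := by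
    intro i hi j hj
    rw [hoff s _ (by simp [hi]), hx i hi j hj, mul_zero]
  have hl (s : ℝ) : leftWeight i₀ j₀ (φ s) = leftWeight i₀ j₀ x := by
    simp [leftWeight_congr_mul (hoff s)]
  have hr (s : ℝ) : rightWeight i₀ j₀ (φ s) = rightWeight i₀ j₀ x := by
    simp [rightWeight_congr_mul (hoff s)]
  have hn (s : ℝ) (hs : s ^ 2 = 1) : ∑ z, ‖φ s z‖ ^ 2 = 1 := by
    rw [sum_normSq_of_cross (hcross s), hl, hr, ← hnorm, sum_normSq_of_cross hx]
    have : ‖φ s (i₀, j₀)‖ ^ 2 = ‖x (i₀, j₀)‖ ^ 2 + c := by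
      rw [← Complex.normSq_eq_norm_sq, ← Complex.normSq_eq_norm_sq, Complex.normSq_apply,
        Complex.normSq_apply]
      simp only [φ, he, Pi.add_apply, Pi.smul_apply, Pi.single_eq_same, smul_eq_mul, mul_one]
      simp [hreal]
      linear_combination s ^ 2 * Real.sq_sqrt hc + c * hs
    rw [this]
    ring
  have hE (s : ℝ) (hs : s ^ 2 = 1) := pureRenyiEntanglement_of_cross (hcross s) (hn s hs) hα
  refine ⟨fun _ => 1 / 2, fun k => φ ((![1, -1] : Fin 2 → ℝ) k), ⟨by norm_num, by simp, ?_, ?_⟩, ?_⟩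
  · intro k
    refine hn _ ?_
    fin_cases k <;> norm_num
  · ext z z'
    have hes : star (e z') = e z' := by
      simp only [he]
      by_cases h : z' = (i₀, j₀)
      · subst h; simp
      · simp [Pi.single_eq_of_ne h]
    have hcs : (Real.sqrt c : ℂ) ^ 2 = c := by exact_mod_cast Real.sq_sqrt hc
    have hI := Complex.I_sq
    simp only [Fin.sum_univ_two, Matrix.add_apply, Matrix.smul_apply, Matrix.vecMulVec_apply, φ,
      Pi.star_apply, Pi.add_apply, Pi.smul_apply, smul_eq_mul, star_add, star_mul', hes]
    simp
    linear_combination (c * e z * e z') * hI + Complex.I ^ 2 * e z * e z' * hcs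
  · simp only [Fin.sum_univ_two, Matrix.cons_val_zero, Matrix.cons_val_one]
    rw [hE 1 (by norm_num), hE (-1) (by norm_num), hl, hl, hr, hr]
    ring

theorem renyiEntanglement_of_cross {i₀ : a} {j₀ : b} {x : a × b → ℂ}
    (hx : ∀ i ≠ i₀, ∀ j ≠ j₀, x (i, j) = 0) (hreal : (x (i₀, j₀)).im = 0) {c : ℝ} (hc : 0 ≤ c)
    (hnorm : ∑ z, ‖x z‖ ^ 2 + c = 1) {α : ℝ} (hα : (Real.sqrt 7 - 1) / 2 ≤ α) :
    renyiEntanglement α (Matrix.vecMulVec x (star x) +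
        (c : ℂ) • Matrix.vecMulVec (Pi.single (i₀, j₀) 1) (Pi.single (i₀, j₀) 1)) =
      renyiOfConcurrence α (2 * Real.sqrt (leftWeight i₀ j₀ x * rightWeight i₀ j₀ x)) := by
  have h7 : (13 : ℝ) / 5 ≤ Real.sqrt 7 := Real.le_sqrt_of_sq_le (by norm_num)
  refine IsLeast.csInf_eq ⟨?_, ?_⟩
  · obtain ⟨q, φ, hd, hE⟩ := exists_pureDecomposition hx hreal hc hnorm (α := α) (by linarith)
    exact ⟨2, q, φ, hd, hE.symm⟩
  · rintro _ ⟨m, q, φ, hd, rfl⟩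
    refine renyiOfConcurrence_le_average hx (fun z hz z' hz' => ?_) hα hd
    simp [Matrix.vecMulVec_apply, Pi.single_eq_of_ne hz]

end

/-! ### The power inequality with Hamming weights -/

/-- With s = t/k ≤ a the middle term is (s + t)^x - s^x, and increments of a convex function over a
length t grow with the starting point. Equality holds at a = s. -/
theorem mul_rpow_add_rpow_le {x k a t : ℝ} (hx : 1 ≤ x) (hk : 0 < k) (ht : 0 ≤ t)
    (hta : t ≤ k * a) :
    a ^ x + ((1 + k) ^ x - 1) / k ^ x * t ^ x ≤ (a + t) ^ x := by
  set s := t / k with hs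
  have hs0 : 0 ≤ s := div_nonneg ht hk.le
  have hsa : s ≤ a := (div_le_iff₀ hk).2 (by linarith)
  have hK : ((1 + k) ^ x - 1) / k ^ x * t ^ x = (s + t) ^ x - s ^ x := by
    have e : s + t = (1 + k) * s := by rw [hs]; field_simp
    rw [e, Real.mul_rpow (by positivity) hs0, hs, Real.div_rpow ht hk.le]
    ring
  rw [hK]
  rcases (by linarith : 0 ≤ a + t - s).eq_or_lt with hL | hL
  · rw [show s + t = a + t by linarith, show s = a by linarith]
    linarith
  have hconv := (convexOn_rpow hx).2
  -- The points s + t and a are convex combinations of s and a + t with interchanged weights, so the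
  -- two convexity inequalities add up to the claim.
  have hd : (a - s) / (a + t - s) + t / (a + t - s) = 1 := by field_simp; ring
  have h1 := hconv (mem_Ici.2 hs0) (mem_Ici.2 (by linarith : 0 ≤ a + t))
    (div_nonneg (by linarith) hL.le) (div_nonneg ht hL.le) hd
  have h2 := hconv (mem_Ici.2 hs0) (mem_Ici.2 (by linarith : 0 ≤ a + t))
    (div_nonneg ht hL.le) (div_nonneg (by linarith) hL.le) ((add_comm _ _).trans hd)
  simp only [smul_eq_mul] at h1 h2
  rw [show (a - s) / (a + t - s) * s + t / (a + t - s) * (a + t) = s + t by field_simp; ring] at h1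
  rw [show t / (a + t - s) * s + (a - s) / (a + t - s) * (a + t) = a by field_simp; ring] at h2
  have h3 : (a - s) / (a + t - s) = 1 - t / (a + t - s) := by linarith
  rw [h3] at h1 h2
  linarith

theorem hammingWeight_zero : hammingWeight 0 = 0 := by simp [hammingWeight]

theorem hammingWeight_two_mul (i : ℕ) : hammingWeight (2 * i) = hammingWeight i := by
  rcases Nat.eq_zero_or_pos i with rfl | hi
  · rfl
  · simp [hammingWeight, Nat.digits_def' one_lt_two (by omega : 0 < 2 * i)]

theorem hammingWeight_two_mul_add_one (i : ℕ) :
    hammingWeight (2 * i + 1) = hammingWeight i + 1 := by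
  have h : (2 * i + 1) / 2 = i := by omega
  simp [hammingWeight, Nat.add_mod, h]

theorem sum_range_two_mul (f : ℕ → ℝ) (N : ℕ) :
    ∑ j ∈ Finset.range (2 * N), f j = ∑ i ∈ Finset.range N, (f (2 * i) + f (2 * i + 1)) := by
  induction N with
  | zero => simp
  | succ N ih => rw [Nat.mul_succ, Finset.sum_range_succ, Finset.sum_range_succ, ih,
      Finset.sum_range_succ, add_assoc]

/-- Merge the entries 2i and 2i + 1: their Hamming weights are those of i, plus 0 and 1, so the
two-term inequality extracts one factor. The pair sums again decay by the ratio k, because k ≤ 1. -/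
theorem sum_hammingWeight_rpow_le {x k : ℝ} (hx : 1 ≤ x) (hk : 0 < k) (hk1 : k ≤ 1) (s : ℕ) :
    ∀ b : ℕ → ℝ, (∀ j, 0 ≤ b j) → (∀ j, b (j + 1) ≤ k * b j) →
      ∑ j ∈ Finset.range (2 ^ s), (((1 + k) ^ x - 1) / k ^ x) ^ hammingWeight j * b j ^ x ≤
        (∑ j ∈ Finset.range (2 ^ s), b j) ^ x := by
  have hK : 0 ≤ ((1 + k) ^ x - 1) / k ^ x :=
    div_nonneg (sub_nonneg.2 (Real.one_le_rpow (by linarith) (by linarith)))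
      (Real.rpow_nonneg hk.le _)
  induction s with
  | zero => intro b _ _; simp [hammingWeight_zero]
  | succ s ih =>
    intro b hb hmono
    have hle (j : ℕ) : b (j + 1) ≤ b j :=
      (hmono j).trans (mul_le_of_le_one_left (hb j) hk1)
    rw [pow_succ', sum_range_two_mul, sum_range_two_mul]
    refine le_trans (Finset.sum_le_sum fun i _ => ?_)
      (ih (fun i => b (2 * i) + b (2 * i + 1)) (fun i => add_nonneg (hb _) (hb _)) fun i => ?_)
    · rw [hammingWeight_two_mul, hammingWeight_two_mul_add_one, pow_succ, mul_assoc, ← mul_add]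
      exact mul_le_mul_of_nonneg_left
        (mul_rpow_add_rpow_le hx hk (hb _) (hmono _)) (pow_nonneg hK _)
    · simp only [mul_add, mul_one]
      exact add_le_add ((hmono (2 * i + 1)).trans (mul_le_mul_of_nonneg_left (hle _) hk.le))
        ((hmono (2 * i + 1 + 1)).trans (mul_le_mul_of_nonneg_left (hle _) hk.le))

theorem sum_fin_hammingWeight_rpow_le {x k : ℝ} (hx : 1 ≤ x) (hk : 0 < k) (hk1 : k ≤ 1) {r : ℕ}
    (b : Fin r → ℝ) (hb : ∀ j, 0 ≤ b j)
    (hmono : ∀ (j : ℕ) (hj : j + 1 < r), b ⟨j + 1, hj⟩ ≤ k * b ⟨j, Nat.lt_of_succ_lt hj⟩) :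
    ∑ j : Fin r, (((1 + k) ^ x - 1) / k ^ x) ^ hammingWeight (j : ℕ) * b j ^ x ≤
      (∑ j, b j) ^ x := by
  -- Padding by zeros up to 2 ^ r keeps the ratio condition and adds only zero terms, as x ≠ 0.
  let c : ℕ → ℝ := fun j => if h : j < r then b ⟨j, h⟩ else 0
  have hc0 (j : ℕ) : 0 ≤ c j := by
    by_cases h : j < r
    · simpa [c, h] using hb ⟨j, h⟩
    · simp [c, h]
  have hc (j : Fin r) : c j = b j := by simp [c]
  have hcr (j : ℕ) (hj : r ≤ j) : c j = 0 := by simp [c, not_lt.2 hj]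
  have hsub : Finset.range r ⊆ Finset.range (2 ^ r) :=
    Finset.range_subset_range.2 Nat.lt_two_pow_self.le
  have h := sum_hammingWeight_rpow_le hx hk hk1 r c hc0 fun j => by
    by_cases h : j + 1 < r
    · have h' : j < r := Nat.lt_of_succ_lt h
      simpa [c, h, h'] using hmono j h
    · rw [hcr _ (not_lt.1 h)]
      exact mul_nonneg hk.le (hc0 j)
  rw [← Finset.sum_subset hsub fun j _ hj => hcr j (by simpa using hj),
    ← Finset.sum_subset hsub fun j _ hj => by
      rw [hcr j (by simpa using hj), Real.zero_rpow (by linarith), mul_zero],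
    ← Fin.sum_univ_eq_sum_range, ← Fin.sum_univ_eq_sum_range] at h
  simpa only [hc] using h

/-! ### Monogamy of the squared entanglement -/

/-- Monogamy of the squared Rényi entanglement, as a property of its dependence on the
concurrence. -/
theorem sum_sq_renyiOfConcurrence_le {α : ℝ} (hα : (Real.sqrt 7 - 1) / 2 ≤ α) {ι : Type*}
    [Fintype ι] {x : ι → ℝ} (hx : ∀ j, 0 ≤ x j) {y : ℝ} (hy0 : 0 ≤ y) (hy1 : y ≤ 1)
    (hxy : ∑ j, x j ^ 2 = y ^ 2) :
    ∑ j, renyiOfConcurrence α (x j) ^ 2 ≤ renyiOfConcurrence α y ^ 2 := by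
  have h7 : (13 : ℝ) / 5 ≤ Real.sqrt 7 := Real.le_sqrt_of_sq_le (by norm_num)
  have hα0 : 0 < α := by linarith
  have hle (j : ι) : x j ≤ y := by
    refine le_of_sq_le_sq ?_ hy0
    rw [← hxy]
    exact Finset.single_le_sum (f := fun j => x j ^ 2) (fun _ _ => sq_nonneg _)
      (Finset.mem_univ j)
  rcases hy0.eq_or_lt with rfl | hy
  · have : ∀ j, x j = 0 := fun j => le_antisymm (hle j) (hx j)
    simp [this, renyiOfConcurrence_zero hα0]
  -- Convexity along the chord from 0, where the function vanishes.
  have hstar (j : ι) : renyiOfConcurrence α (x j) ≤ x j / y * renyiOfConcurrence α y := by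
    have h := (convexOn_renyiOfConcurrence hα).2 (left_mem_Icc.2 zero_le_one)
      (⟨hy0, hy1⟩ : y ∈ Icc (0 : ℝ) 1) (sub_nonneg.2 ((div_le_one hy).2 (hle j)))
      (div_nonneg (hx j) hy0) (sub_add_cancel 1 (x j / y))
    simp only [smul_eq_mul, mul_zero, zero_add, renyiOfConcurrence_zero hα0] at h
    rwa [div_mul_cancel₀ _ hy.ne'] at h
  calc ∑ j, renyiOfConcurrence α (x j) ^ 2
      ≤ ∑ j, (x j / y * renyiOfConcurrence α y) ^ 2 :=
        Finset.sum_le_sum fun j _ =>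
          pow_le_pow_left₀ (renyiOfConcurrence_nonneg hα0 _) (hstar j) 2
    _ = renyiOfConcurrence α y ^ 2 := by
        simp only [mul_pow, div_pow]
        rw [← Finset.sum_mul, ← Finset.sum_div, hxy, div_self (by positivity), one_mul]

/-! ### Reduced states of vectors with at most one excitation -/

/-- The basis label which is `u` on the qudits satisfying `p` and `0` on the others. -/
def zeroExtend {n d : ℕ} [NeZero d] (p : Fin n → Prop) [DecidablePred p]
    (u : {i // p i} → Fin d) : Fin n → Fin d :=
  fun i => if h : p i then u ⟨i, h⟩ else 0

/-- The total weight of `ψ` on the basis labels which do not vanish on the qudit `s`. -/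
noncomputable def siteWeight {n d : ℕ} [NeZero d] (ψ : (Fin n → Fin d) → ℂ) (s : Fin n) : ℝ :=
  ∑ z with z s ≠ 0, ‖ψ z‖ ^ 2

/-- `ψ` is a combination of basis vectors with at most one excited qudit. -/
def AtMostOneExcited {n d : ℕ} [NeZero d] (ψ : (Fin n → Fin d) → ℂ) : Prop :=
  ∀ z i j, i ≠ j → z i ≠ 0 → z j ≠ 0 → ψ z = 0

variable {n d : ℕ} [NeZero d] {ψ : (Fin n → Fin d) → ℂ}

theorem siteWeight_nonneg (ψ : (Fin n → Fin d) → ℂ) (s : Fin n) : 0 ≤ siteWeight ψ s :=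
  Finset.sum_nonneg fun _ _ => sq_nonneg _

/-- A nonvacuum label in the support of `ψ` has exactly one excited qudit, so no label is counted
twice. -/
theorem sum_siteWeight (hψ : AtMostOneExcited ψ) (S : Finset (Fin n)) :
    ∑ s ∈ S, siteWeight ψ s = ∑ z with z ≠ 0 ∧ ∀ i ∉ S, z i = 0, ‖ψ z‖ ^ 2 := by
  simp only [siteWeight, Finset.sum_filter]
  rw [Finset.sum_comm]
  refine Finset.sum_congr rfl fun z _ => ?_
  by_cases hz : ψ z = 0
  · simp [hz]
  by_cases h : ∃ s ∈ S, z s ≠ 0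
  · obtain ⟨s, hs, hzs⟩ := h
    have huniq (i : Fin n) (hi : i ≠ s) : z i = 0 := by
      by_contra hzi
      exact hz (hψ z i s hi hzi hzs)
    rw [if_pos ⟨fun h0 => hzs (by simp [h0]), fun i hi => huniq i fun his => hi (his ▸ hs)⟩,
      Finset.sum_eq_single s (fun i _ his => if_neg (by simp [huniq i his]))
        (fun h => absurd hs h), if_pos hzs]
  · push Not at h
    rw [if_neg, Finset.sum_eq_zero fun s hs => if_neg (by simp [h s hs])]
    rintro ⟨h0, h1⟩
    refine h0 (funext fun i => ?_)
    by_cases hi : i ∈ S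
    · exact h i hi
    · exact h1 i hi

theorem sum_zeroExtend (ψ : (Fin n → Fin d) → ℂ) (p : Fin n → Prop) [DecidablePred p]
    [Fintype {i // p i}] :
    ∑ u ∈ Finset.univ.erase (0 : {i // p i} → Fin d), ‖ψ (zeroExtend p u)‖ ^ 2 =
      ∑ z with z ≠ 0 ∧ ∀ i, ¬ p i → z i = 0, ‖ψ z‖ ^ 2 := by
  refine Finset.sum_bij' (fun u _ => zeroExtend p u) (fun z _ i => z i.1) ?_ ?_ ?_ ?_ ?_
  · intro u hu
    simp only [Finset.mem_erase, Finset.mem_univ, and_true, Finset.mem_filter, true_and] at hu ⊢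
    refine ⟨fun h => hu (funext fun i => ?_), fun i hi => by simp [zeroExtend, hi]⟩
    simpa [zeroExtend, i.2] using congrFun h i.1
  · intro z hz
    simp only [Finset.mem_erase, Finset.mem_univ, and_true, Finset.mem_filter, true_and] at hz ⊢
    refine fun h => hz.1 (funext fun i => ?_)
    by_cases hi : p i
    · exact congrFun h ⟨i, hi⟩
    · exact hz.2 i hi
  · intro u _
    ext i
    simp [zeroExtend, i.2]
  · intro z hz
    simp only [Finset.mem_filter, Finset.mem_univ, true_and] at hz
    ext i
    by_cases hi : p i
    · simp [zeroExtend, hi]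
    · simp [zeroExtend, hi, hz.2 i hi]
  · intro u _
    rfl

theorem sum_normSq_eq (hψ : AtMostOneExcited ψ) :
    ∑ z, ‖ψ z‖ ^ 2 = ‖ψ 0‖ ^ 2 + ∑ s, siteWeight ψ s := by
  rw [sum_siteWeight hψ, ← Finset.add_sum_erase _ _ (Finset.mem_univ 0)]
  congr 1
  refine Finset.sum_congr ?_ fun _ _ => rfl
  ext z
  simp

theorem extend_glue_apply {X Y : Finset (Fin n)} (u : (X → Fin d) × (Y → Fin d))
    (e : {i // i ∉ X ∪ Y} → Fin d) (i : Fin n) :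
    extend (X ∪ Y) (glue X Y u) e i = if h : i ∈ X then u.1 ⟨i, h⟩
      else if h : i ∈ Y then u.2 ⟨i, h⟩ else if h : i ∉ X ∪ Y then e ⟨i, h⟩ else 0 := by
  by_cases hX : i ∈ X
  · simp [extend, glue, hX]
  · by_cases hY : i ∈ Y
    · simp [extend, glue, hX, hY]
    · simp [extend, hX, hY]

/-- Tracing out a vacuum environment gives the cross-supported vector `x`; the excited environments
contribute only to the vacuum projector, with total weight `c`. -/
theorem cutEntanglement_eq (hψ : AtMostOneExcited ψ) (hreal : (ψ 0).im = 0)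
    (hnorm : ∑ z, ‖ψ z‖ ^ 2 = 1) {X Y : Finset (Fin n)} (hXY : Disjoint X Y)
    {α : ℝ} (hα : (Real.sqrt 7 - 1) / 2 ≤ α) :
    cutEntanglement α ψ X Y = renyiOfConcurrence α
      (2 * Real.sqrt ((∑ s ∈ X, siteWeight ψ s) * ∑ s ∈ Y, siteWeight ψ s)) := by
  let g (u : (X → Fin d) × (Y → Fin d)) (e : {i // i ∉ X ∪ Y} → Fin d) : Fin n → Fin d :=
    extend (X ∪ Y) (glue X Y u) e
  have hg := extend_glue_apply (d := d) (X := X) (Y := Y)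
  have hgX (u e) (i : X) : g u e i = u.1 i := by simp [g, hg]
  have hgY (u e) (i : Y) : g u e i = u.2 i := by
    simp [g, hg, Finset.disjoint_right.1 hXY i.2]
  have hgE (u e) (i : {i // i ∉ X ∪ Y}) : g u e i = e i := by
    have := i.2
    rw [Finset.mem_union, not_or] at this
    simp [g, hg, this.1, this.2]
  set x : (X → Fin d) × (Y → Fin d) → ℂ := fun u => ψ (g u 0) with hxdef
  have hg0 : g 0 0 = 0 := by
    ext i
    simp only [g, hg]
    split_ifs <;> rfl
  have hx : ∀ u ≠ 0, ∀ v ≠ 0, x (u, v) = 0 := by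
    intro u hu v hv
    obtain ⟨i, hi⟩ := Function.ne_iff.1 hu
    obtain ⟨j, hj⟩ := Function.ne_iff.1 hv
    refine hψ _ i.1 j.1 (fun h => Finset.disjoint_left.1 hXY i.2 (h ▸ j.2)) ?_ ?_
    · rwa [hgX]
    · rwa [hgY]
  -- An excitation inside `X ∪ Y` excludes one in the environment.
  have hge (u) (hu : u ≠ 0) (e) (he : e ≠ 0) : ψ (g u e) = 0 := by
    obtain ⟨j, hj⟩ := Function.ne_iff.1 he
    have hjX : j.1 ∉ X := fun h => j.2 (Finset.mem_union_left _ h)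
    have hjY : j.1 ∉ Y := fun h => j.2 (Finset.mem_union_right _ h)
    by_cases h1 : u.1 = 0
    · have h2 : u.2 ≠ 0 := fun h2 => hu (Prod.ext h1 h2)
      obtain ⟨i, hi⟩ := Function.ne_iff.1 h2
      exact hψ _ i.1 j.1 (fun h => hjY (h ▸ i.2)) (by rwa [hgY]) (by rwa [hgE])
    · obtain ⟨i, hi⟩ := Function.ne_iff.1 h1
      exact hψ _ i.1 j.1 (fun h => hjX (h ▸ i.2)) (by rwa [hgX]) (by rwa [hgE])
  have hl : leftWeight 0 0 x = ∑ s ∈ X, siteWeight ψ s := by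
    rw [sum_siteWeight hψ, ← sum_zeroExtend ψ (fun i => i ∈ X), leftWeight]
    refine Finset.sum_congr rfl fun u _ => ?_
    have : g (u, 0) 0 = zeroExtend (fun i => i ∈ X) u := by
      ext i
      simp only [g, hg, zeroExtend]
      split_ifs <;> rfl
    simp only [hxdef, this]
  have hr : rightWeight 0 0 x = ∑ s ∈ Y, siteWeight ψ s := by
    rw [sum_siteWeight hψ, ← sum_zeroExtend ψ (fun i => i ∈ Y), rightWeight]
    refine Finset.sum_congr rfl fun u _ => ?_
    have : g (0, u) 0 = zeroExtend (fun i => i ∈ Y) u := by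
      ext i
      simp only [g, hg, zeroExtend]
      split_ifs with h1 h2
      · exact absurd h2 (Finset.disjoint_left.1 hXY h1)
      all_goals rfl
    simp only [hxdef, this]
  set c : ℝ := ∑ e ∈ Finset.univ.erase (0 : {i // i ∉ X ∪ Y} → Fin d), ‖ψ (g 0 e)‖ ^ 2 with hc
  have hcw : c = ∑ s ∈ (X ∪ Y)ᶜ, siteWeight ψ s := by
    have hS := sum_zeroExtend ψ (fun i => i ∉ X ∪ Y)
    rw [sum_siteWeight hψ]
    simp only [Finset.mem_compl]
    rw [← hS]
    refine Finset.sum_congr rfl fun e _ => ?_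
    have : g 0 e = zeroExtend (fun i => i ∉ X ∪ Y) e := by
      ext i
      by_cases h : i ∈ X ∪ Y
      · rcases Finset.mem_union.1 h with h' | h'
        · simpa [zeroExtend, h'] using congrArg Fin.val (hgX 0 e ⟨i, h'⟩)
        · simpa [zeroExtend, h'] using congrArg Fin.val (hgY 0 e ⟨i, h'⟩)
      · have := hgE 0 e ⟨i, h⟩
        simp only at this
        rw [this, zeroExtend, dif_pos h]
    rw [this]
  have hxnorm : ∑ z, ‖x z‖ ^ 2 + c = 1 := by
    rw [sum_normSq_of_cross hx, hl, hr, hcw, ← hnorm, sum_normSq_eq hψ,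
      ← Finset.sum_add_sum_compl (X ∪ Y), Finset.sum_union hXY]
    have : x (0, 0) = ψ 0 := congrArg ψ hg0
    rw [this]
    ring
  have hρ : bipartiteDensity ψ X Y = Matrix.vecMulVec x (star x) +
      (c : ℂ) • Matrix.vecMulVec (Pi.single (0, 0) 1) (Pi.single (0, 0) 1) := by
    ext u v
    simp only [bipartiteDensity, Matrix.submatrix_apply, reducedDensity, Matrix.vecMulVec_apply,
      Pi.star_apply, Matrix.add_apply, Matrix.smul_apply, smul_eq_mul]
    rw [← Finset.add_sum_erase _ _ (Finset.mem_univ 0)]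
    congr 1
    change ∑ e ∈ Finset.univ.erase 0, ψ (g u e) * star (ψ (g v e)) = _
    by_cases hu : u = 0
    · by_cases hv : v = 0
      · subst hu hv
        change _ = (c : ℂ) * ((Pi.single 0 1 : _ → ℂ) 0 * (Pi.single 0 1 : _ → ℂ) 0)
        rw [Pi.single_eq_same, hc]
        simp [Complex.mul_conj, Complex.normSq_eq_norm_sq]
      · rw [Pi.single_eq_of_ne (show v ≠ (0, 0) from hv), mul_zero, mul_zero]
        exact Finset.sum_eq_zero fun e he => by simp [hge v hv e (Finset.ne_of_mem_erase he)]
    · rw [Pi.single_eq_of_ne (show u ≠ (0, 0) from hu), zero_mul, mul_zero]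
      exact Finset.sum_eq_zero fun e he => by simp [hge u hu e (Finset.ne_of_mem_erase he)]
  rw [cutEntanglement, hρ, renyiEntanglement_of_cross hx
    (by rw [show x (0, 0) = ψ 0 from congrArg ψ hg0]; exact hreal)
    (Finset.sum_nonneg fun _ _ => sq_nonneg _) hxnorm hα, hl, hr]

/-! ### GWV states -/

theorem wVector_zero (a : Fin n → Fin d → ℂ) : wVector a 0 = 0 := by
  simp only [wVector, Finset.sum_apply, Pi.smul_apply, ket]
  refine Finset.sum_eq_zero fun s _ => Finset.sum_eq_zero fun i hi => ?_
  rw [Pi.single_eq_of_ne, smul_zero]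
  intro h
  exact Finset.ne_of_mem_erase hi (by simpa using (congrFun h s).symm)

theorem wVector_update (a : Fin n → Fin d → ℂ) (s : Fin n) {i : Fin d} (hi : i ≠ 0) :
    wVector a (Function.update (fun _ => 0) s i) = a s i := by
  simp only [wVector, Finset.sum_apply, Pi.smul_apply, ket]
  rw [Finset.sum_eq_single s, Finset.sum_eq_single i]
  · simp
  · intro j _ hj
    rw [Pi.single_eq_of_ne, smul_zero]
    intro h
    exact hj (by simpa using (congrFun h s).symm)
  · simp [hi]
  · intro t _ ht
    refine Finset.sum_eq_zero fun j _ => ?_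
    rw [Pi.single_eq_of_ne, smul_zero]
    intro h
    exact hi (by simpa [ht.symm] using congrFun h s)
  · simp

theorem wVector_eq_zero (a : Fin n → Fin d → ℂ) {z : Fin n → Fin d} {i j : Fin n} (hij : i ≠ j)
    (hi : z i ≠ 0) (hj : z j ≠ 0) : wVector a z = 0 := by
  simp only [wVector, Finset.sum_apply, Pi.smul_apply, ket]
  refine Finset.sum_eq_zero fun s _ => Finset.sum_eq_zero fun l _ => ?_
  rw [Pi.single_eq_of_ne, smul_zero]
  rintro rfl
  by_cases his : i = s
  · exact hj (Function.update_of_ne (fun h => hij (his.trans h.symm)) _ _)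
  · exact hi (Function.update_of_ne his _ _)

theorem IsGWV.atMostOneExcited (hψ : IsGWV ψ) : AtMostOneExcited ψ := by
  obtain ⟨p, a, -, -, -, rfl⟩ := hψ
  intro z i j hij hi hj
  have hz : z ≠ fun _ => 0 := fun h => hi (by rw [h])
  simp [wVector_eq_zero a hij hi hj, ket, Pi.single_eq_of_ne hz]

/-- The vacuum amplitude is √(1 - p); its reality is what the optimal two-state decomposition uses.
-/
theorem IsGWV.im_zero (hψ : IsGWV ψ) : (ψ 0).im = 0 := by
  obtain ⟨p, a, -, -, -, rfl⟩ := hψ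
  have : ket (fun _ => 0) (0 : Fin n → Fin d) = 1 := Pi.single_eq_same (M := fun _ => ℂ) _ _
  simp [wVector_zero, this]

theorem siteWeight_eq_sum_update (hψ : AtMostOneExcited ψ)
    (s : Fin n) : siteWeight ψ s =
      ∑ i ∈ Finset.univ.erase 0, ‖ψ (Function.update (fun _ => 0) s i)‖ ^ 2 := by
  have hinj : Function.Injective fun i : Fin d => Function.update (fun _ : Fin n => (0 : Fin d)) s i :=
    fun i j h => by simpa using congrFun h s
  rw [siteWeight, ← Finset.sum_image (f := fun z => ‖ψ z‖ ^ 2) hinj.injOn]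
  refine (Finset.sum_subset ?_ fun z hz hz' => ?_).symm
  · intro z hz
    obtain ⟨i, hi, rfl⟩ := Finset.mem_image.1 hz
    simpa using hi
  · have hzs : z s ≠ 0 := by simpa using hz
    have : ∃ j, j ≠ s ∧ z j ≠ 0 := by
      by_contra! h
      refine hz' (Finset.mem_image.2 ⟨z s, by simpa using hzs, ?_⟩)
      ext j
      by_cases hj : j = s
      · subst hj; simp
      · simp [hj, h j hj]
    obtain ⟨j, hj, hzj⟩ := this
    simp [hψ z j s hj hzj hzs]

theorem IsGWV.sum_normSq (hψ : IsGWV ψ) : ∑ z, ‖ψ z‖ ^ 2 = 1 := by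
  rw [sum_normSq_eq hψ.atMostOneExcited]
  simp only [siteWeight_eq_sum_update hψ.atMostOneExcited]
  obtain ⟨p, a, hp0, hp1, ha, rfl⟩ := hψ
  have h0 : ket (fun _ => 0) (0 : Fin n → Fin d) = 1 := Pi.single_eq_same (M := fun _ => ℂ) _ _
  have h1 (s : Fin n) : ∑ i ∈ Finset.univ.erase (0 : Fin d),
      ‖((Real.sqrt p : ℂ) • wVector a + (Real.sqrt (1 - p) : ℂ) • ket (fun _ => 0) :
        (Fin n → Fin d) → ℂ) (Function.update (fun _ => 0) s i)‖ ^ 2 =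
      p * ∑ i ∈ Finset.univ.erase 0, ‖a s i‖ ^ 2 := by
    rw [Finset.mul_sum]
    refine Finset.sum_congr rfl fun i hi => ?_
    have hi0 := Finset.ne_of_mem_erase hi
    have hne : Function.update (fun _ => (0 : Fin d)) s i ≠ fun _ => 0 :=
      fun h => hi0 (by simpa using congrFun h s)
    simp [wVector_update a s hi0, ket, Pi.single_eq_of_ne hne, mul_pow, Real.sq_sqrt hp0]
  simp only [h1, ← Finset.mul_sum, ha]
  simp [wVector_zero, h0, Real.sq_sqrt (sub_nonneg.2 hp1)]

end GWV

/-! ### The monogamy inequality -/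

theorem theorem8 {n d r : ℕ} [NeZero d] (hr : 1 ≤ r)
    (ψ : (Fin n → Fin d) → ℂ) (hψ : GWV.IsGWV ψ)
    (P : Finset (Fin n)) (Q : Fin r → Finset (Fin n))
    (hP : P.Nonempty) (hQ : ∀ j, (Q j).Nonempty)
    (hPQ : ∀ j, Disjoint P (Q j)) (hQQ : ∀ i j, i ≠ j → Disjoint (Q i) (Q j))
    (α β k : ℝ) (hα : (Real.sqrt 7 - 1) / 2 ≤ α) (hβ : 2 ≤ β) (hk0 : 0 < k) (hk1 : k ≤ 1)
    (hmono : ∀ (j : ℕ) (hj : j + 1 < r),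
      GWV.cutEntanglement α ψ P (Q ⟨j + 1, hj⟩) ^ 2 ≤
        k * GWV.cutEntanglement α ψ P (Q ⟨j, Nat.lt_of_succ_lt hj⟩) ^ 2) :
    ∑ j : Fin r, (((1 + k) ^ (β / 2) - 1) / k ^ (β / 2)) ^ GWV.hammingWeight (j : ℕ) *
        GWV.cutEntanglement α ψ P (Q j) ^ β ≤
      GWV.cutEntanglement α ψ P (Finset.univ.biUnion Q) ^ β := by
  have h7 : (13 : ℝ) / 5 ≤ Real.sqrt 7 := Real.le_sqrt_of_sq_le (by norm_num)
  have hα0 : 0 < α := by linarith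
  have hPU : Disjoint P (Finset.univ.biUnion Q) :=
    (Finset.disjoint_biUnion_right _ _ _).2 fun j _ => hPQ j
  have hcut {Y : Finset (Fin n)} (hY : Disjoint P Y) :=
    GWV.cutEntanglement_eq hψ.atMostOneExcited hψ.im_zero hψ.sum_normSq hY hα
  have hw0 (S : Finset (Fin n)) : 0 ≤ ∑ s ∈ S, GWV.siteWeight ψ s :=
    Finset.sum_nonneg fun s _ => GWV.siteWeight_nonneg ψ s
  have hnonneg {Y : Finset (Fin n)} (hY : Disjoint P Y) : 0 ≤ GWV.cutEntanglement α ψ P Y := by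
    rw [hcut hY]
    exact GWV.renyiOfConcurrence_nonneg hα0 _
  -- Passing to squares turns the exponent β into β/2 ≥ 1, to which the Hamming weight inequality
  -- applies.
  have hpow {Y : Finset (Fin n)} (hY : Disjoint P Y) :
      GWV.cutEntanglement α ψ P Y ^ β = (GWV.cutEntanglement α ψ P Y ^ 2) ^ (β / 2) := by
    rw [← Real.rpow_natCast, ← Real.rpow_mul (hnonneg hY)]
    congr 1
    push_cast
    ring
  -- The squared concurrences 4w(P)w(Q j) add up exactly to that of the union.
  have hsuper : ∑ j, GWV.cutEntanglement α ψ P (Q j) ^ 2 ≤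
      GWV.cutEntanglement α ψ P (Finset.univ.biUnion Q) ^ 2 := by
    simp only [hcut (hPQ _), hcut hPU]
    refine GWV.sum_sq_renyiOfConcurrence_le hα (fun j => by positivity) (by positivity)
      (GWV.two_mul_sqrt_mul_le_one (hw0 _) (hw0 _) ?_) ?_
    · rw [← Finset.sum_union hPU]
      have h := GWV.sum_normSq_eq hψ.atMostOneExcited
      rw [hψ.sum_normSq] at h
      have := Finset.sum_le_sum_of_subset_of_nonneg (Finset.subset_univ (P ∪ Finset.univ.biUnion Q))
        fun s _ _ => GWV.siteWeight_nonneg ψ s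
      linarith [sq_nonneg ‖ψ 0‖]
    · simp only [mul_pow, Real.sq_sqrt (mul_nonneg (hw0 _) (hw0 _))]
      rw [Finset.sum_biUnion fun i _ j _ hij => hQQ i j hij, Finset.mul_sum, Finset.mul_sum]
  simp only [hpow (hPQ _), hpow hPU]
  exact (GWV.sum_fin_hammingWeight_rpow_le (by linarith) hk0 hk1 _ (fun j => sq_nonneg _)
    hmono).trans (Real.rpow_le_rpow (Finset.sum_nonneg fun j _ => sq_nonneg _) hsuper
      (by linarith))
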